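/- Let $H$ be a complex Hilbert space (inner product linear in the first variable), let $A_1,\dots,A_d$ be bounded operators on $H$ and let $A_{d+1}$ be a (possibly unbounded) densely defined closed operator on $H$. The vector $(A_1,\dots,A_{d+1})$ is called *Siegel–dissipative* if (i) $(0,+\infty)$ is contained in the resolvent set of $iA_{d+1}$; (ii) $A_1,\dots,A_d$ commute with each other and strongly commute with $A_{d+1}$, i.e. $A_j v\in\operatorname{Dom}A_{d+1}$ and $A_{d+1}A_jv=A_jA_{d+1}v$ for all $v\in\operatorname{Dom}A_{d+1}$; (iii) $\operatorname{Im}\langle A_{d+1}v,v\rangle\ge\frac14\sum_{i=1}^d\|A_iv\|^2$ for all $v\in\operatorname{Dom}A_{d+1}$. It is *strongly Siegel–dissipative* if $(A_1,\dots,A_d,A_{d+1}-i\varepsilon\,\mathrm{Id})$ is Siegel–dissipative for some $\varepsilon>0$. In that case let $H_\Delta$ be $\operatorname{Dom}A_{d+1}$ with the inner product $$\langle v,v'\rangle_\Delta=\frac1{2i}\big(\langle A_{d+1}v,v'\rangle-\langle v,A_{d+1}v'\rangle\big)-\frac14\sum_{i=1}^d\langle A_iv,A_iv'\rangle ,$$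 and let $\widehat H_\Delta\supseteq H_\Delta$ be its Hilbert space completion. On $\mathbb N_0^d\times\mathbb R_-$, where $\mathbb R_-=(-\infty,0)$, put $d\mu(\alpha,\lambda)=\alpha!\,(2/|\lambda|)^{|\alpha|}|\lambda|^{2d}\,d\alpha\,d\lambda$ ($d\alpha$ counting measure, $d\lambda$ Lebesgue measure). For $\gamma\in\mathbb N_0^d$ and $\tau<0$ let $S_{\gamma,\tau}$ be the operator on $L^2(\mathbb N_0^d\times\mathbb R_-,d\mu)$ given by $(S_{\gamma,\tau}\varphi)(\alpha,\lambda)=\frac{|\lambda-\tau|^d}{|\lambda|^d}\varphi(\alpha-\gamma,\lambda-\tau)$ if $\lambda<\tau$ and $\alpha\ge\gamma$, and $0$ otherwise. Write $A^\alpha=A_1^{\alpha_1}\cdots A_d^{\alpha_d}$. **Theorem.** Let $(A_1,\dots,A_{d+1})$ be strongly Siegel–dissipative. Then $iA_{d+1}$ generates a unique strongly continuous semigroup of contractions $\{e^{-i\tau A_{d+1}}\}_{\tau\le0}$ (with parameter $t=-\tau\ge 0$). For $v\in H$ consider the formula $$(\Theta v)(\alpha,\lambda)=\frac{|\lambda|^{|\alpha|-d}}{\alpha!\,2^{|\alpha|-\frac12}}\;e^{-i\lambda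 A_{d+1}}A^\alpha v ,\qquad(\alpha,\lambda)\in\mathbb N_0^d\times\mathbb R_-,\tag{$*$}$$ whose right-hand side is an element of $H_\Delta$ whenever $e^{-i\lambda A_{d+1}}A^\alpha v\in\operatorname{Dom}A_{d+1}$. 1. If $v\in\operatorname{Dom}A_{d+1}$, then $e^{-i\lambda A_{d+1}}A^\alpha v\in\operatorname{Dom}A_{d+1}$ for all $(\alpha,\lambda)$. For every $v\in H$ with this last property, $(*)$ defines an element of $L^2(\mathbb N_0^d\times\mathbb R_-,d\mu;H_\Delta)$ whose norm is $\|v\|_H$. 2. There is a linear isometric embedding $\Theta:H\to L^2(\mathbb N_0^d\times\mathbb R_-,d\mu;\widehat H_\Delta)$ such that, for every $v\in H$, $(*)$ holds for almost every $(\alpha,\lambda)$ with $e^{-i\lambda A_{d+1}}A^\alpha v\in\operatorname{Dom}A_{d+1}$. 3. For all $\gamma\in\mathbb N_0^d$ and $\tau<0$, the operator $S_{\gamma,\tau}$ is bounded on $L^2(d\mu)$, there is a bounded operator $S_{\gamma,\tau}^*\otimes\mathrm{Id}$ on $L^2(d\mu;\widehat H_\Delta)$ with $(S_{\gamma,\tau}^*\otimes\mathrm{Id})(\varphi\otimes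 x)=(S_{\gamma,\tau}^*\varphi)\otimes x$ for all $\varphi\in L^2(d\mu)$, $x\in\widehat H_\Delta$, it is given by $$[(S_{\gamma,\tau}^*\otimes\mathrm{Id})g](\alpha,\lambda)=\frac{|\lambda+\tau|^{d-|\alpha|-|\gamma|}}{|\lambda|^{d-|\alpha|}}\,\frac{(\alpha+\gamma)!}{\alpha!}\,2^{|\gamma|}\,g(\alpha+\gamma,\lambda+\tau),$$ and $\Theta\, e^{-i\tau A_{d+1}}A^\gamma=(S_{\gamma,\tau}^*\otimes\mathrm{Id})\,\Theta$ on $H$. -/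

import Mathlib

open MeasureTheory Filter Topology
open scoped NNReal ENNReal

noncomputable section

namespace Siegel

section Operators

variable {H : Type*} [NormedAddCommGroup H] [InnerProductSpace ℂ H]

/-- The complex number `z` lies in the resolvent set of the (possibly unbounded) operator `G`:
`z - G` maps `Dom G` bijectively onto `H`, with bounded inverse `R`. -/
def InResolventSet (G : H →ₗ.[ℂ] H) (z : ℂ) : Prop :=
  ∃ R : H →L[ℂ] H, ∀ v w : H, R v = w ↔ ∃ h : w ∈ G.domain, z • w - G ⟨w, h⟩ = v

/-- The possibly unbounded operator `U` and the bounded operator `T` strongly commute: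
`U T` is an extension of `T U`. -/
def StronglyCommute (U : H →ₗ.[ℂ] H) (T : H →L[ℂ] H) : Prop :=
  ∀ v : U.domain, ∃ h : T v ∈ U.domain, U ⟨T v, h⟩ = T (U v)

/-- `(A 0, …, A (d-1), B)` is a Siegel-dissipative vector of commuting operators; `B` is the last,
possibly unbounded, operator. Mathlib's `inner ℂ v w` is linear in `w`, so `inner ℂ v (B v)` is
`⟨B v, v⟩` for an inner product linear in its first variable. -/
structure SiegelDissipative {d : ℕ} (A : Fin d → H →L[ℂ] H) (B : H →ₗ.[ℂ] H) : Prop where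
  dense_domain : Dense (B.domain : Set H)
  closed : B.IsClosed
  resolvent : ∀ x : ℝ, 0 < x → InResolventSet (Complex.I • B) (x : ℂ)
  commute : ∀ i j, Commute (A i) (A j)
  strongly_commute : ∀ i, StronglyCommute B (A i)
  dissipative : ∀ v : B.domain,
    (1 / 4 : ℝ) * ∑ i, ‖A i (v : H)‖ ^ 2 ≤ (inner ℂ (v : H) (B v)).im

/-- The operator `B - iε`, with the same domain as `B`. -/
def shiftDown (B : H →ₗ.[ℂ] H) (ε : ℝ) : H →ₗ.[ℂ] H :=
  (-(Complex.I * (ε : ℂ)) • (LinearMap.id : H →ₗ[ℂ] H)) +ᵥ B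

/-- `(A 0, …, A (d-1), B)` is strongly Siegel-dissipative: for some `ε > 0`, the vector
`(A 0, …, A (d-1), B - iε)` is Siegel-dissipative. -/
def StronglySiegelDissipative {d : ℕ} (A : Fin d → H →L[ℂ] H) (B : H →ₗ.[ℂ] H) : Prop :=
  ∃ ε : ℝ, 0 < ε ∧ SiegelDissipative A (shiftDown B ε)

/-- `T` is a strongly continuous semigroup of contractions. -/
structure IsContractionSemigroup (T : ℝ≥0 → H →L[ℂ] H) : Prop where
  zero : T 0 = ContinuousLinearMap.id ℂ H
  add : ∀ s t, T (s + t) = (T s).comp (T t)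
  contraction : ∀ t, ‖T t‖ ≤ 1
  continuous_zero : ∀ v, Tendsto (fun t => T t v) (𝓝[>] 0) (𝓝 v)

/-- `G` is the infinitesimal generator of `T`: for all `v` and `w`, the difference quotients
`(T t v - v) / t` tend to `w` as `t` decreases to `0` if and only if `v ∈ Dom G` and `G v = w`. -/
def IsGenerator (T : ℝ≥0 → H →L[ℂ] H) (G : H →ₗ.[ℂ] H) : Prop :=
  ∀ v w : H, Tendsto (fun t : ℝ≥0 => ((t : ℝ) : ℂ)⁻¹ • (T t v - v)) (𝓝[>] 0) (𝓝 w) ↔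
    ∃ h : v ∈ G.domain, G ⟨v, h⟩ = w

/-- `A ^ α = A₁ ^ α₁ ⋯ A_d ^ α_d`. -/
def monomialOp {d : ℕ} (A : Fin d → H →L[ℂ] H) (α : Fin d → ℕ) : H →L[ℂ] H :=
  (List.ofFn fun i => A i ^ α i).prod

theorem StronglySiegelDissipative.exists_bound {d : ℕ} {A : Fin d → H →L[ℂ] H}
    {B : H →ₗ.[ℂ] H} (h : StronglySiegelDissipative A B) :
    ∃ ε : ℝ, 0 < ε ∧ ∀ v : B.domain, ε * ‖(v : H)‖ ^ 2 ≤
      (inner ℂ (v : H) (B v)).im - (1 / 4 : ℝ) * ∑ i, ‖A i (v : H)‖ ^ 2 := by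
  obtain ⟨ε, hε, hd⟩ := h
  refine ⟨ε, hε, fun v => ?_⟩
  have h1 := hd.dissipative v
  have h2 : (shiftDown B ε) v = -(Complex.I * (ε : ℂ)) • (v : H) + B v := rfl
  rw [h2, inner_add_right, inner_smul_right, inner_self_eq_norm_sq_to_K, Complex.add_im] at h1
  have h3 : (-(Complex.I * (ε : ℂ)) * ((‖(v : H)‖ : ℝ) : ℂ) ^ 2).im = -(ε * ‖(v : H)‖ ^ 2) := by
    rw [← Complex.ofReal_pow, ← neg_mul_eq_neg_mul, mul_assoc, ← Complex.ofReal_mul,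
      Complex.neg_im, Complex.I_mul_im, Complex.ofReal_re]
  have h4 := h1.trans_eq (congrArg (· + _) h3)
  linarith

/-- The space `H_Δ`: the vector space `Dom B` with the inner product
`⟨v, v'⟩_Δ = (1 / 2i) (⟨B v, v'⟩ - ⟨v, B v'⟩) - (1 / 4) ∑ i, ⟨A i v, A i v'⟩`. -/
def HDelta {d : ℕ} {A : Fin d → H →L[ℂ] H} {B : H →ₗ.[ℂ] H}
    (_h : StronglySiegelDissipative A B) : Type _ := B.domain

section HDelta

variable {d : ℕ} {A : Fin d → H →L[ℂ] H} {B : H →ₗ.[ℂ] H} (h : StronglySiegelDissipative A B)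

instance HDelta.instAddCommGroup : AddCommGroup (HDelta h) :=
  inferInstanceAs (AddCommGroup B.domain)

instance HDelta.instModule : Module ℂ (HDelta h) :=
  inferInstanceAs (Module ℂ B.domain)

/-- The element of `H_Δ` given by a vector of `Dom B`. -/
def HDelta.mk (v : H) (hv : v ∈ B.domain) : HDelta h := (⟨v, hv⟩ : B.domain)

/-- The inner product of `H_Δ`, written, as is done in Mathlib, so that it is linear in the second
variable `w` (`innerDelta h v w` is the number `⟨w, v⟩_Δ`). -/
def HDelta.innerDelta (v w : B.domain) : ℂ :=
  (1 / (2 * Complex.I)) * (inner ℂ (v : H) (B w) - inner ℂ (B v) (w : H))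
    - (1 / 4) * ∑ i, inner ℂ (A i (v : H)) (A i (w : H))

theorem HDelta.innerDelta_self_re (v : B.domain) :
    (HDelta.innerDelta (A := A) v v).re
      = (inner ℂ (v : H) (B v)).im - (1 / 4 : ℝ) * ∑ i, ‖A i (v : H)‖ ^ 2 := by
  have h1 : inner ℂ (B v) (v : H) = (starRingEnd ℂ) (inner ℂ (v : H) (B v)) :=
    (inner_conj_symm _ _).symm
  have h2 : (∑ i, inner ℂ (A i (v : H)) (A i (v : H)) : ℂ)
      = ((∑ i, ‖A i (v : H)‖ ^ 2 : ℝ) : ℂ) := by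
    push_cast
    exact Finset.sum_congr rfl fun i _ => inner_self_eq_norm_sq_to_K _
  have h3 : (1 / (2 * Complex.I)) * (inner ℂ (v : H) (B v)
      - (starRingEnd ℂ) (inner ℂ (v : H) (B v))) = (((inner ℂ (v : H) (B v)).im : ℝ) : ℂ) := by
    rw [Complex.sub_conj]
    field_simp
    push_cast
    ring
  rw [HDelta.innerDelta, h1, h2, h3]
  have h4 : ((1 : ℂ) / 4) = ((1 / 4 : ℝ) : ℂ) := by push_cast; rfl
  rw [h4, ← Complex.ofReal_mul, ← Complex.ofReal_sub, Complex.ofReal_re]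

/-- The inner product axioms for `⟨·, ·⟩_Δ` on `Dom B`. -/
@[reducible]
def HDelta.coreDom (h : StronglySiegelDissipative A B) : InnerProductSpace.Core ℂ B.domain where
  inner v w := HDelta.innerDelta (A := A) v w
  conj_inner_symm v w := by
    change (starRingEnd ℂ) (HDelta.innerDelta (A := A) w v) = HDelta.innerDelta (A := A) v w
    simp only [HDelta.innerDelta, map_sub, map_mul, map_sum, inner_conj_symm, map_div₀, map_one,
      Complex.conj_I, map_ofNat]
    field_simp
    ring
  re_inner_nonneg v := by
    obtain ⟨ε, hε, hb⟩ := h.exists_bound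
    change 0 ≤ (HDelta.innerDelta (A := A) v v).re
    rw [HDelta.innerDelta_self_re]
    exact le_trans (by positivity) (hb v)
  add_left u v w := by
    change HDelta.innerDelta (A := A) (u + v) w
      = HDelta.innerDelta (A := A) u w + HDelta.innerDelta (A := A) v w
    simp only [HDelta.innerDelta, LinearPMap.map_add, Submodule.coe_add, inner_add_left, map_add,
      Finset.sum_add_distrib]
    ring
  smul_left v w r := by
    change HDelta.innerDelta (A := A) (r • v) w
      = (starRingEnd ℂ) r * HDelta.innerDelta (A := A) v w
    simp only [HDelta.innerDelta, LinearPMap.map_smul, Submodule.coe_smul, inner_smul_left,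
      map_smul, ← Finset.mul_sum]
    ring
  definite v hv := by
    obtain ⟨ε, hε, hb⟩ := h.exists_bound
    have h0 : (HDelta.innerDelta (A := A) v v).re = 0 := by
      have : HDelta.innerDelta (A := A) v v = 0 := hv
      rw [this, Complex.zero_re]
    have h1 := hb v
    rw [← HDelta.innerDelta_self_re, h0] at h1
    have h2 : ‖(v : H)‖ ^ 2 = 0 := le_antisymm (by nlinarith) (by positivity)
    have h3 : (v : H) = 0 := by simpa using h2
    exact Subtype.ext h3

/-- The inner product axioms for `H_Δ`. -/
@[reducible]
def HDelta.core : InnerProductSpace.Core ℂ (HDelta h) := HDelta.coreDom h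

instance HDelta.instNormedAddCommGroup : NormedAddCommGroup (HDelta h) :=
  @InnerProductSpace.Core.toNormedAddCommGroup ℂ (HDelta h) _ _ _ (HDelta.core h)

instance HDelta.instInnerProductSpace : InnerProductSpace ℂ (HDelta h) :=
  InnerProductSpace.ofCore (HDelta.core h).toCore

end HDelta

end Operators

/-- The negative half-line `ℝ_-`. -/
abbrev NegReal : Type := Set.Iio (0 : ℝ)

/-- `-s` for `s < 0`, as a nonnegative real: with `T` the semigroup generated by `i B`,
`T (negTime s)` is the operator `e^{-i s B}`. -/
def negTime (s : NegReal) : ℝ≥0 := ⟨-(s : ℝ), neg_nonneg.2 (le_of_lt s.2)⟩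

/-- The sum of two negative reals. -/
def addNeg (s t : NegReal) : NegReal := ⟨(s : ℝ) + (t : ℝ), Set.mem_Iio.2 (add_neg s.2 t.2)⟩

/-- `|α| = α₁ + ⋯ + α_d`. -/
def deg {d : ℕ} (α : Fin d → ℕ) : ℕ := ∑ i, α i

/-- `α! = α₁! ⋯ α_d!`. -/
def multiFactorial {d : ℕ} (α : Fin d → ℕ) : ℕ := ∏ i, (α i).factorial

/-- The measure `dμ(α, s) = α! (2 / |s|) ^ |α| |s| ^ (2d) dα ds` on `ℕ^d × ℝ_-`, where `dα` is the
counting measure and `ds` is Lebesgue measure. -/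
def mu (d : ℕ) : Measure ((Fin d → ℕ) × NegReal) :=
  ((Measure.count : Measure (Fin d → ℕ)).prod ((volume : Measure ℝ).comap Subtype.val : Measure NegReal)).withDensity fun p =>
    ENNReal.ofReal ((multiFactorial p.1 : ℝ) * (2 / |(p.2 : ℝ)|) ^ deg p.1
      * |(p.2 : ℝ)| ^ (2 * d))

/-- The formula defining the weighted shift `S_{γ,τ}` on functions on `ℕ^d × ℝ_-`:
`(|s - τ| ^ d / |s| ^ d) φ(α - γ, s - τ)` if `s < τ` and `γ ≤ α`, and `0` otherwise. -/
def shiftFun {d : ℕ} (γ : Fin d → ℕ) (τ : NegReal) (φ : (Fin d → ℕ) × NegReal → ℂ) :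
    (Fin d → ℕ) × NegReal → ℂ :=
  open Classical in fun p =>
    if hp : (p.2 : ℝ) < (τ : ℝ) ∧ γ ≤ p.1 then
      ((|(p.2 : ℝ) - (τ : ℝ)| ^ d / |(p.2 : ℝ)| ^ d : ℝ) : ℂ)
        * φ (p.1 - γ, ⟨(p.2 : ℝ) - (τ : ℝ), sub_neg.2 hp.1⟩)
    else 0

/-- The bounded operator `S` on `L²(μ)` is the weighted shift `S_{γ,τ}`. -/
def IsWeightedShift {d : ℕ} (γ : Fin d → ℕ) (τ : NegReal)
    (S : Lp ℂ 2 (mu d) →L[ℂ] Lp ℂ 2 (mu d)) : Prop :=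
  ∀ φ : Lp ℂ 2 (mu d), S φ =ᵐ[mu d] shiftFun γ τ φ

/-- The elementary tensor `φ ⊗ x`, i.e. the function `p ↦ φ(p) x` in `L²(μ; E)`. -/
def elemTensor {d : ℕ} {E : Type*} [NormedAddCommGroup E] [NormedSpace ℂ E]
    (φ : Lp ℂ 2 (mu d)) (x : E) : Lp E 2 (mu d) :=
  (ContinuousLinearMap.toSpanSingleton ℂ x).compLp φ

/-- `W` is the operator `R ⊗ Id` on `L²(μ; E)`: the bounded operator with
`W (φ ⊗ x) = (R φ) ⊗ x`. It is unique, since elementary tensors span a dense subspace. -/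
def IsTensorId {d : ℕ} {E : Type*} [NormedAddCommGroup E] [NormedSpace ℂ E]
    (R : Lp ℂ 2 (mu d) →L[ℂ] Lp ℂ 2 (mu d)) (W : Lp E 2 (mu d) →L[ℂ] Lp E 2 (mu d)) : Prop :=
  ∀ (φ : Lp ℂ 2 (mu d)) (x : E), W (elemTensor φ x) = elemTensor (R φ) x

/-- The explicit formula for the lifted adjoint shift `S_{γ,τ}^* ⊗ Id`:
`(|s + τ| ^ (d - |α| - |γ|) / |s| ^ (d - |α|)) ((α + γ)! / α!) 2 ^ |γ| g(α + γ, s + τ)`. -/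
def adjShiftFun {d : ℕ} {E : Type*} [NormedAddCommGroup E] [NormedSpace ℂ E]
    (γ : Fin d → ℕ) (τ : NegReal) (g : (Fin d → ℕ) × NegReal → E) :
    (Fin d → ℕ) × NegReal → E := fun p =>
  ((|(p.2 : ℝ) + (τ : ℝ)| ^ ((d : ℤ) - (deg p.1 : ℤ) - (deg γ : ℤ))
      / |(p.2 : ℝ)| ^ ((d : ℤ) - (deg p.1 : ℤ))
      * ((multiFactorial (p.1 + γ) : ℝ) / (multiFactorial p.1 : ℝ)) * 2 ^ deg γ : ℝ) : ℂ)
    • g (p.1 + γ, addNeg p.2 τ)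

/-- The scalar `|s| ^ (|α| - d) / (α! 2 ^ (|α| - 1/2))`. -/
def thetaCoeff {d : ℕ} (p : (Fin d → ℕ) × NegReal) : ℝ :=
  |(p.2 : ℝ)| ^ ((deg p.1 : ℤ) - (d : ℤ))
    / ((multiFactorial p.1 : ℝ) * (2 : ℝ) ^ ((deg p.1 : ℝ) - 1 / 2))

section Theta

variable {H : Type*} [NormedAddCommGroup H] [InnerProductSpace ℂ H]
  {d : ℕ} {A : Fin d → H →L[ℂ] H} {B : H →ₗ.[ℂ] H}

/-- With `T` the semigroup generated by `i B`: the vector `e^{-i s B} A ^ α v`. -/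
def orbit (A : Fin d → H →L[ℂ] H) (T : ℝ≥0 → H →L[ℂ] H) (v : H)
    (p : (Fin d → ℕ) × NegReal) : H :=
  T (negTime p.2) (monomialOp A p.1 v)

/-- The value `(|s| ^ (|α| - d) / (α! 2 ^ (|α| - 1/2))) e^{-i s B} A ^ α v`, as an element of `H_Δ`,
at a point `p = (α, s)` where `e^{-i s B} A ^ α v` belongs to `Dom B`. -/
def thetaVal (h : StronglySiegelDissipative A B) (T : ℝ≥0 → H →L[ℂ] H) (v : H)
    (p : (Fin d → ℕ) × NegReal) (hp : orbit A T v p ∈ B.domain) : HDelta h :=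
  ((thetaCoeff p : ℝ) : ℂ) • HDelta.mk h (orbit A T v p) hp

end Theta

end Siegel

end

/-!
The operator `G = i B` is densely defined, dissipative, and has `(0, ∞)` in its resolvent set, so it
generates a contraction semigroup `T` (Hille-Yosida); `T` is built as the limit of the exponentials
of the Yosida approximations of `G`. To keep proofs of membership in `Dom G` out of the way, this
part speaks of the graph of `G` (`IsMaximalDissipative`, `Generates`). Two curves with right
derivative in the graph that start at the same point agree, since the norm of their difference does
not increase. This gives uniqueness of the semigroup, and also its commutation with every bounded
operator that strongly commutes with `G`, such as the `A i` (`IsContractionSemigroup.intertwine`).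

The norm of `Θ v` is computed from an energy balance. The definition of `‖·‖_Δ` says that
`d/dt ‖T t w‖² = -2 ‖T t w‖_Δ² - 1/2 ∑ i, ‖T t A i w‖²`. Apply this to all words of length `n` in
the `A i`, multiply by `t ^ n / (2 ^ n n!)` and sum over `n ≤ N`: the terms with `‖·‖²` telescope,
but for one rest term, and what remains, by the multinomial formula `wordSum_eq_sum`, is the
integrand of `‖Θ v‖²`. Strong dissipativity bounds all partial sums of the energy at time `t` by
`exp (-2 ε t) ‖v‖²`. So the energy tends to zero at infinity, and the rest term, itself half of a
sum of terms of the energies of the vectors `A i v`, tends to zero by dominated convergence; all of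
`‖v‖²` is dissipated (`tendsto_lintegral_energyLoss`, `eLpNorm_thetaVal`).

The isometry thus obtained on the dense subspace `Dom B` extends to `H`. The formula for `Θ v` at
the points where it makes sense follows by approximating `v` by `n (n - G)⁻¹ v`
(`coeFn_isometry`).

Finally, the operator `g ↦ adjShiftFun γ τ g` is bounded on `L²(μ; E)` by a comparison of densities
that comes from the binomial theorem (`adjCoeff_mul_shiftCoeff_le`). For `E = ℂ` its adjoint is the
weighted shift, by a change of variables (`isWeightedShift_adjoint`), and the intertwining relation
holds pointwise on `Dom B`, hence everywhere (`isometry_intertwines`).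
-/

/-! ### Generation of contraction semigroups -/

namespace Siegel

section Generation

variable {H : Type*} [NormedAddCommGroup H] [InnerProductSpace ℂ H]

/-- The graph `Γ` is that of a densely defined maximal dissipative operator `G`: `Re ⟨G v, v⟩ ≤ 0`
on `Dom G`, and `x - G` is invertible for all `x > 0`. Working with the graph, as a set of pairs,
avoids carrying proofs of membership in `Dom G`. -/
structure IsMaximalDissipative (Γ : Submodule ℂ (H × H)) : Prop where
  re_inner_nonpos : ∀ v w, (v, w) ∈ Γ → (inner ℂ v w).re ≤ 0
  exists_resolvent : ∀ x : ℝ, 0 < x → ∃ R : H →L[ℂ] H,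
    ∀ v w : H, R v = w ↔ (w, (x : ℂ) • w - v) ∈ Γ
  dense : Dense {v : H | ∃ w, (v, w) ∈ Γ}

theorem cauchySeq_of_dense {X : ℕ → H →L[ℂ] H} (hX : ∀ n v, ‖X n v‖ ≤ ‖v‖) {s : Set H}
    (hs : Dense s) (h : ∀ v ∈ s, CauchySeq fun n => X n v) (v : H) :
    CauchySeq fun n => X n v := by
  rw [Metric.cauchySeq_iff']
  intro ε hε
  obtain ⟨u, hu, huv⟩ := Metric.mem_closure_iff.1 (hs v) (ε / 3) (by positivity)
  obtain ⟨N, hN⟩ := Metric.cauchySeq_iff'.1 (h u hu) (ε / 3) (by positivity)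
  refine ⟨N, fun n hn => ?_⟩
  have h1 : ∀ k, dist (X k v) (X k u) < ε / 3 := fun k => by
    rw [dist_eq_norm, ← map_sub]
    exact (hX k _).trans_lt (by rwa [← dist_eq_norm])
  have h2 := h1 N
  rw [dist_comm] at h2
  calc dist (X n v) (X N v) ≤ dist (X n v) (X n u) + dist (X n u) (X N u) + dist (X N u) (X N v) :=
        dist_triangle4 _ _ _ _
    _ < ε := by linarith [h1 n, hN n hn]

theorem tendsto_of_dense {ι : Type*} {l : Filter ι} {X : ι → H →L[ℂ] H}
    (hX : ∀ n v, ‖X n v‖ ≤ ‖v‖)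
    {s : Set H} (hs : Dense s) (h : ∀ v ∈ s, Tendsto (fun n => X n v) l (𝓝 v)) (v : H) :
    Tendsto (fun n => X n v) l (𝓝 v) := by
  rw [Metric.tendsto_nhds]
  intro ε hε
  obtain ⟨u, hu, huv⟩ := Metric.mem_closure_iff.1 (hs v) (ε / 3) (by positivity)
  filter_upwards [Metric.tendsto_nhds.1 (h u hu) (ε / 3) (by positivity)] with n hn
  have h1 : dist (X n v) (X n u) < ε / 3 := by
    rw [dist_eq_norm, ← map_sub]
    exact (hX n _).trans_lt (by rwa [← dist_eq_norm])
  rw [dist_comm] at huv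
  calc dist (X n v) v ≤ dist (X n v) (X n u) + dist (X n u) u + dist u v :=
        dist_triangle4 _ _ _ _
    _ < ε := by linarith

theorem hasDerivWithinAt_norm_sq {f : ℝ → H} {f' : H} {s : Set ℝ} {x : ℝ}
    (h : HasDerivWithinAt f f' s x) :
    HasDerivWithinAt (fun t => ‖f t‖ ^ 2) (2 * (inner ℂ (f x) f').re) s x :=
  letI : InnerProductSpace ℝ H := InnerProductSpace.rclikeToReal ℂ H
  h.norm_sq

theorem hasDerivAt_norm_sq {f : ℝ → H} {f' : H} {x : ℝ} (h : HasDerivAt f f' x) :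
    HasDerivAt (fun t => ‖f t‖ ^ 2) (2 * (inner ℂ (f x) f').re) x :=
  letI : InnerProductSpace ℝ H := InnerProductSpace.rclikeToReal ℂ H
  h.norm_sq

/-- A curve whose right derivative is everywhere dissipative has non-increasing norm. -/
theorem norm_le_of_deriv_right_dissipative {f f' : ℝ → H} (hc : ContinuousOn f (Set.Ici 0))
    (hd : ∀ t, 0 ≤ t → HasDerivWithinAt f (f' t) (Set.Ici t) t)
    (hn : ∀ t, 0 ≤ t → (inner ℂ (f t) (f' t)).re ≤ 0) {t : ℝ} (ht : 0 ≤ t) : ‖f t‖ ≤ ‖f 0‖ := by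
  have h1 : ‖f t‖ ^ 2 ≤ ‖f 0‖ ^ 2 := by
    refine image_le_of_deriv_right_le_deriv_boundary (f := fun t => ‖f t‖ ^ 2)
      (f' := fun t => 2 * (inner ℂ (f t) (f' t)).re) (a := 0) (b := t)
      (B := fun _ => ‖f 0‖ ^ 2) (B' := fun _ => 0) ?_
      (fun x hx => hasDerivWithinAt_norm_sq (hd x hx.1)) le_rfl continuousOn_const
      (fun x _ => hasDerivWithinAt_const _ _ _) (fun x hx => ?_) ⟨ht, le_rfl⟩
    · exact (hc.mono fun x hx => hx.1).norm.pow 2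
    · have := hn x hx.1
      linarith
  exact le_of_sq_le_sq h1 (norm_nonneg _)

section Exp

variable [CompleteSpace H]

theorem hasDerivAt_exp_smul_apply (X : H →L[ℂ] H) (v : H) (t : ℝ) :
    HasDerivAt (fun s : ℝ => NormedSpace.exp (s • X) v) (X (NormedSpace.exp (t • X) v)) t := by
  have h1 := hasDerivAt_exp_smul_const' (𝕂 := ℝ) X t
  exact ((ContinuousLinearMap.apply ℂ H v).restrictScalars ℝ).hasFDerivAt.comp_hasDerivAt t h1

theorem norm_exp_smul_apply_le {X : H →L[ℂ] H} (hX : ∀ v, (inner ℂ v (X v)).re ≤ 0) {t : ℝ}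
    (ht : 0 ≤ t) (v : H) : ‖NormedSpace.exp (t • X) v‖ ≤ ‖v‖ := by
  have h1 := norm_le_of_deriv_right_dissipative (f := fun s : ℝ => NormedSpace.exp (s • X) v)
    (f' := fun s => X (NormedSpace.exp (s • X) v))
    (fun s _ => (hasDerivAt_exp_smul_apply X v s).continuousAt.continuousWithinAt)
    (fun s _ => (hasDerivAt_exp_smul_apply X v s).hasDerivWithinAt) (fun s _ => hX _) ht
  simpa using h1

theorem norm_exp_apply_le {X : H →L[ℂ] H} (hX : ∀ v, (inner ℂ v (X v)).re ≤ 0) (v : H) :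
    ‖NormedSpace.exp X v‖ ≤ ‖v‖ := by
  simpa using norm_exp_smul_apply_le hX zero_le_one v

theorem commute_exp_apply {X Y : H →L[ℂ] H} (h : Commute X Y) (v : H) :
    NormedSpace.exp X (Y v) = Y (NormedSpace.exp X v) := by
  have : Commute (NormedSpace.exp X) Y := h.exp_left
  exact DFunLike.congr_fun this.eq v

/-- The exponentials of commuting dissipative bounded operators depend on the operators in a
Lipschitz way, with constant one: differentiate along the segment joining the operators. -/
theorem norm_exp_sub_exp_apply_le {X Y : H →L[ℂ] H} (hX : ∀ v, (inner ℂ v (X v)).re ≤ 0)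
    (hY : ∀ v, (inner ℂ v (Y v)).re ≤ 0) (hc : Commute X Y) (v : H) :
    ‖NormedSpace.exp X v - NormedSpace.exp Y v‖ ≤ ‖X v - Y v‖ := by
  have hc' : Commute Y (X - Y) := (hc.symm.sub_right (Commute.refl Y))
  have h1 : ∀ s : ℝ, HasDerivAt (fun s : ℝ => NormedSpace.exp (Y + s • (X - Y)) v)
      (NormedSpace.exp (Y + s • (X - Y)) ((X - Y) v)) s := by
    intro s
    have h2 : ∀ s : ℝ, NormedSpace.exp (Y + s • (X - Y)) =
        NormedSpace.exp Y * NormedSpace.exp (s • (X - Y)) := fun s => by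
      let _ : NormedAlgebra ℚ (H →L[ℂ] H) := NormedAlgebra.restrictScalars ℚ ℝ _
      exact NormedSpace.exp_add_of_commute (hc'.smul_right s)
    simp only [h2]
    have h3 := hasDerivAt_exp_smul_const (𝕂 := ℝ) (X - Y) s
    exact (((NormedSpace.exp Y).comp (ContinuousLinearMap.apply ℂ H v)).restrictScalars
      ℝ).hasFDerivAt.comp_hasDerivAt s h3
  have h4 := norm_image_sub_le_of_norm_deriv_right_le_segment (a := 0) (b := 1)
    (f := fun s : ℝ => NormedSpace.exp (Y + s • (X - Y)) v)
    (f' := fun s => NormedSpace.exp (Y + s • (X - Y)) ((X - Y) v)) (C := ‖X v - Y v‖)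
    (fun s _ => (h1 s).continuousAt.continuousWithinAt) (fun s _ => (h1 s).hasDerivWithinAt)
    (fun s hs => ?_) 1 ⟨zero_le_one, le_rfl⟩
  · simpa using h4
  · refine norm_exp_apply_le (fun w => ?_) _
    have h5 : (Y + s • (X - Y)) w = ((1 - s : ℝ) : ℂ) • Y w + (s : ℂ) • X w := by
      simp [sub_smul, smul_sub]
      abel
    rw [h5, inner_add_right, inner_smul_right, inner_smul_right, Complex.add_re,
      Complex.re_ofReal_mul, Complex.re_ofReal_mul]
    have := mul_nonneg (sub_nonneg.2 hs.2.le) (neg_nonneg.2 (hY w))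
    have := mul_nonneg hs.1 (neg_nonneg.2 (hX w))
    linarith

end Exp

namespace IsMaximalDissipative

variable {Γ : Submodule ℂ (H × H)} (hΓ : IsMaximalDissipative Γ)

/-- The resolvent `(n + 1 - G)⁻¹` of a maximal dissipative operator `G`; the shift by one keeps the
point positive for all `n`. -/
noncomputable def res (n : ℕ) : H →L[ℂ] H :=
  (hΓ.exists_resolvent ((n : ℝ) + 1) (by positivity)).choose

theorem res_eq_iff (n : ℕ) (v w : H) :
    hΓ.res n v = w ↔ (w, (((n : ℝ) + 1 : ℝ) : ℂ) • w - v) ∈ Γ :=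
  (hΓ.exists_resolvent ((n : ℝ) + 1) (by positivity)).choose_spec v w

theorem res_mem (n : ℕ) (v : H) :
    (hΓ.res n v, (((n : ℝ) + 1 : ℝ) : ℂ) • hΓ.res n v - v) ∈ Γ :=
  (hΓ.res_eq_iff n v _).1 rfl

theorem res_sub_apply (n : ℕ) {v w : H} (h : (v, w) ∈ Γ) :
    hΓ.res n ((((n : ℝ) + 1 : ℝ) : ℂ) • v - w) = v := by
  rw [res_eq_iff]
  simpa using h

/-- The approximate identity `(n + 1) (n + 1 - G)⁻¹`. -/
noncomputable def approx (n : ℕ) : H →L[ℂ] H := (((n : ℝ) + 1 : ℝ) : ℂ) • hΓ.res n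

theorem approx_apply (n : ℕ) (v : H) :
    hΓ.approx n v = (((n : ℝ) + 1 : ℝ) : ℂ) • hΓ.res n v := rfl

theorem approx_sub_self (n : ℕ) {v w : H} (h : (v, w) ∈ Γ) :
    hΓ.approx n v - v = hΓ.res n w := by
  have h1 := hΓ.res_sub_apply n h
  rw [map_sub, map_smul] at h1
  rw [approx_apply, sub_eq_iff_eq_add, ← sub_eq_iff_eq_add', h1]

theorem approx_mem (n : ℕ) {v w : H} (h : (v, w) ∈ Γ) : (hΓ.approx n v, hΓ.approx n w) ∈ Γ := by
  have h1 := Γ.smul_mem (((n : ℝ) + 1 : ℝ) : ℂ) (hΓ.res_mem n v)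
  rwa [← approx_apply, hΓ.approx_sub_self n h] at h1

theorem approx_mem_domain (n : ℕ) (v : H) : ∃ w, (hΓ.approx n v, w) ∈ Γ :=
  ⟨_, Γ.smul_mem (((n : ℝ) + 1 : ℝ) : ℂ) (hΓ.res_mem n v)⟩

theorem norm_approx_le (n : ℕ) (v : H) : ‖hΓ.approx n v‖ ≤ ‖v‖ := by
  have hn : (0 : ℝ) < (n : ℝ) + 1 := by positivity
  have h1 := hΓ.re_inner_nonpos _ _ (hΓ.res_mem n v)
  rw [inner_sub_right, inner_smul_right, inner_self_eq_norm_sq_to_K, Complex.sub_re,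
    Complex.re_ofReal_mul] at h1
  have h2 : (((‖hΓ.res n v‖ : ℝ) : ℂ) ^ 2).re = ‖hΓ.res n v‖ ^ 2 := by
    rw [← Complex.ofReal_pow, Complex.ofReal_re]
  have h3 : (inner ℂ (hΓ.res n v) v).re ≤ ‖hΓ.res n v‖ * ‖v‖ := re_inner_le_norm (𝕜 := ℂ) _ _
  rw [approx_apply, norm_smul, Complex.norm_real, Real.norm_of_nonneg hn.le]
  have h4 : ((n : ℝ) + 1) * ‖hΓ.res n v‖ ^ 2 ≤ ‖hΓ.res n v‖ * ‖v‖ := by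
    have h5 := h1
    change ((n : ℝ) + 1) * (((‖hΓ.res n v‖ : ℝ) : ℂ) ^ 2).re - _ ≤ 0 at h5
    rw [h2] at h5
    linarith
  rcases (norm_nonneg (hΓ.res n v)).eq_or_lt with h0 | h0
  · rw [← h0]
    simp
  · refine le_of_mul_le_mul_left ?_ h0
    linarith

theorem tendsto_approx (v : H) : Tendsto (fun n => hΓ.approx n v) atTop (𝓝 v) := by
  refine tendsto_of_dense hΓ.norm_approx_le hΓ.dense (fun u hu => ?_) v
  obtain ⟨w, hw⟩ := hu
  rw [tendsto_iff_norm_sub_tendsto_zero]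
  have h1 : ∀ n : ℕ, ‖hΓ.approx n u - u‖ ≤ ‖w‖ * (1 / ((n : ℝ) + 1)) := fun n => by
    have hn : (0 : ℝ) < (n : ℝ) + 1 := by positivity
    rw [hΓ.approx_sub_self n hw, mul_one_div, le_div_iff₀ hn]
    have h2 := hΓ.norm_approx_le n w
    rwa [approx_apply, norm_smul, Complex.norm_real, Real.norm_of_nonneg hn.le, mul_comm] at h2
  refine squeeze_zero (fun _ => norm_nonneg _) h1 ?_
  simpa using (tendsto_one_div_add_atTop_nhds_zero_nat (𝕜 := ℝ)).const_mul ‖w‖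

/-- The resolvent identity. -/
theorem res_sub_res (m n : ℕ) (v : H) :
    hΓ.res m v - hΓ.res n v = ((n : ℂ) - m) • hΓ.res m (hΓ.res n v) := by
  rw [← map_smul, eq_comm, res_eq_iff]
  convert Γ.sub_mem (hΓ.res_mem m v) (hΓ.res_mem n v) using 1
  refine Prod.ext rfl ?_
  simp only [Prod.snd_sub]
  push_cast
  module

theorem commute_res (m n : ℕ) : Commute (hΓ.res m) (hΓ.res n) := by
  rcases eq_or_ne m n with rfl | h
  · exact Commute.refl _
  ext v
  have h0 : ((n : ℂ) - m) ≠ 0 := sub_ne_zero.2 (by exact_mod_cast h.symm)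
  have h1 := hΓ.res_sub_res m n v
  have h2 := hΓ.res_sub_res n m v
  refine smul_right_injective H h0 ?_
  change ((n : ℂ) - m) • hΓ.res m (hΓ.res n v) = ((n : ℂ) - m) • hΓ.res n (hΓ.res m v)
  rw [← h1, ← neg_sub (hΓ.res n v), h2, ← neg_smul, neg_sub]

/-- The Yosida approximation `(n + 1) G (n + 1 - G)⁻¹` of a maximal dissipative operator `G`. -/
noncomputable def yosida (n : ℕ) : H →L[ℂ] H :=
  (((n : ℝ) + 1 : ℝ) : ℂ) • (hΓ.approx n - 1)

theorem yosida_apply (n : ℕ) (v : H) :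
    hΓ.yosida n v = (((n : ℝ) + 1 : ℝ) : ℂ) • (hΓ.approx n v - v) := rfl

theorem yosida_apply_of_mem (n : ℕ) {v w : H} (h : (v, w) ∈ Γ) :
    hΓ.yosida n v = hΓ.approx n w := by
  rw [yosida_apply, hΓ.approx_sub_self n h, approx_apply]

theorem re_inner_yosida_nonpos (n : ℕ) (v : H) : (inner ℂ v (hΓ.yosida n v)).re ≤ 0 := by
  have hn : (0 : ℝ) < (n : ℝ) + 1 := by positivity
  have h1 := hΓ.re_inner_nonpos _ _ (hΓ.res_mem n v)
  rw [yosida_apply, inner_smul_right, Complex.re_ofReal_mul]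
  have h2 : inner ℂ v (hΓ.approx n v - v) =
      inner ℂ (hΓ.approx n v) (hΓ.approx n v - v)
        - inner ℂ (hΓ.approx n v - v) (hΓ.approx n v - v) := by
    rw [← inner_sub_left, sub_sub_cancel]
  have h3 : 0 ≤ (inner ℂ (hΓ.approx n v - v) (hΓ.approx n v - v)).re :=
    inner_self_nonneg (𝕜 := ℂ)
  have h4 : (inner ℂ (hΓ.approx n v) (hΓ.approx n v - v)).re ≤ 0 := by
    rw [← approx_apply] at h1
    nth_rw 1 [approx_apply]
    rw [inner_smul_left, Complex.conj_ofReal, Complex.re_ofReal_mul]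
    exact mul_nonpos_of_nonneg_of_nonpos hn.le h1
  rw [h2, Complex.sub_re]
  exact mul_nonpos_of_nonneg_of_nonpos hn.le (by linarith)

theorem commute_yosida (m n : ℕ) : Commute (hΓ.yosida m) (hΓ.yosida n) :=
  ((((((hΓ.commute_res m n).smul_left _).smul_right _).sub_left (Commute.one_left _)).sub_right
    (Commute.one_right _)).smul_left _).smul_right _

theorem re_inner_smul_yosida_nonpos {t : ℝ} (ht : 0 ≤ t) (n : ℕ) (v : H) :
    (inner ℂ v ((t • hΓ.yosida n) v)).re ≤ 0 := by
  have h1 : (t • hΓ.yosida n) v = (t : ℂ) • hΓ.yosida n v := by simp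
  rw [h1, inner_smul_right, Complex.re_ofReal_mul]
  exact mul_nonpos_of_nonneg_of_nonpos ht (hΓ.re_inner_yosida_nonpos n v)

variable [CompleteSpace H]

theorem cauchySeq_exp_yosida {t : ℝ} (ht : 0 ≤ t) (v : H) :
    CauchySeq fun n => NormedSpace.exp (t • hΓ.yosida n) v := by
  refine cauchySeq_of_dense (X := fun n => NormedSpace.exp (t • hΓ.yosida n))
    (fun n w => norm_exp_apply_le (hΓ.re_inner_smul_yosida_nonpos ht n) w) hΓ.dense
    (fun u hu => ?_) v
  obtain ⟨w, hw⟩ := hu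
  have h1 : CauchySeq fun n => t • hΓ.approx n w :=
    ((hΓ.tendsto_approx w).const_smul t).cauchySeq
  rw [Metric.cauchySeq_iff'] at h1 ⊢
  intro ε hε
  obtain ⟨N, hN⟩ := h1 ε hε
  refine ⟨N, fun n hn => lt_of_le_of_lt ?_ (hN n hn)⟩
  rw [dist_eq_norm, dist_eq_norm]
  refine (norm_exp_sub_exp_apply_le (hΓ.re_inner_smul_yosida_nonpos ht n)
    (hΓ.re_inner_smul_yosida_nonpos ht N)
    (((hΓ.commute_yosida n N).smul_left t).smul_right t) u).trans_eq ?_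
  rw [smul_apply, smul_apply,
    hΓ.yosida_apply_of_mem n hw, hΓ.yosida_apply_of_mem N hw]

theorem exists_tendsto_exp_yosida (t : ℝ≥0) : ∃ T : H →L[ℂ] H,
    ∀ v, Tendsto (fun n => NormedSpace.exp ((t : ℝ) • hΓ.yosida n) v) atTop (𝓝 (T v)) := by
  choose f hf using fun v : H => cauchySeq_tendsto_of_complete (hΓ.cauchySeq_exp_yosida t.2 v)
  exact ⟨continuousLinearMapOfTendsto (fun n => NormedSpace.exp ((t : ℝ) • hΓ.yosida n))
    (tendsto_pi_nhds.2 hf), hf⟩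

/-- The contraction semigroup generated by a maximal dissipative operator, as the limit of the
exponentials of its Yosida approximations. -/
noncomputable def semigroup (t : ℝ≥0) : H →L[ℂ] H := (hΓ.exists_tendsto_exp_yosida t).choose

theorem tendsto_semigroup (t : ℝ≥0) (v : H) :
    Tendsto (fun n => NormedSpace.exp ((t : ℝ) • hΓ.yosida n) v) atTop (𝓝 (hΓ.semigroup t v)) :=
  (hΓ.exists_tendsto_exp_yosida t).choose_spec v

theorem norm_semigroup_apply_le (t : ℝ≥0) (v : H) : ‖hΓ.semigroup t v‖ ≤ ‖v‖ :=
  le_of_tendsto (hΓ.tendsto_semigroup t v).norm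
    (Eventually.of_forall fun n => norm_exp_apply_le (hΓ.re_inner_smul_yosida_nonpos t.2 n) v)

theorem norm_exp_yosida_sub_le {v w : H} (h : (v, w) ∈ Γ) (t : ℝ≥0) (n : ℕ) :
    ‖NormedSpace.exp ((t : ℝ) • hΓ.yosida n) v - v‖ ≤ t * ‖w‖ := by
  have h1 := norm_exp_sub_exp_apply_le (hΓ.re_inner_smul_yosida_nonpos t.2 n)
    (Y := 0) (by simp) (Commute.zero_right _) v
  rw [NormedSpace.exp_zero] at h1
  refine h1.trans ?_
  simp only [smul_apply, zero_apply, sub_zero]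
  rw [norm_smul, hΓ.yosida_apply_of_mem n h, Real.norm_of_nonneg t.2]
  exact mul_le_mul_of_nonneg_left (hΓ.norm_approx_le n w) t.2

/-- The continuity at `0` of the approximating exponentials is uniform in the approximation. -/
theorem exists_norm_exp_yosida_sub_le (v : H) {ε : ℝ} (hε : 0 < ε) :
    ∃ δ : ℝ, 0 < δ ∧ ∀ t : ℝ≥0, (t : ℝ) ≤ δ → ∀ n,
      ‖NormedSpace.exp ((t : ℝ) • hΓ.yosida n) v - v‖ ≤ ε := by
  obtain ⟨u, ⟨w, hw⟩, huv⟩ := Metric.mem_closure_iff.1 (hΓ.dense v) (ε / 3) (by positivity)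
  refine ⟨ε / 3 / (‖w‖ + 1), by positivity, fun t ht n => ?_⟩
  rw [le_div_iff₀ (by positivity)] at ht
  have h1 := hΓ.norm_exp_yosida_sub_le hw t n
  have h2 : ‖NormedSpace.exp ((t : ℝ) • hΓ.yosida n) (v - u)‖ ≤ ‖v - u‖ :=
    norm_exp_apply_le (hΓ.re_inner_smul_yosida_nonpos t.2 n) _
  rw [dist_eq_norm] at huv
  have h3 : NormedSpace.exp ((t : ℝ) • hΓ.yosida n) v - v =
      NormedSpace.exp ((t : ℝ) • hΓ.yosida n) (v - u)
        + (NormedSpace.exp ((t : ℝ) • hΓ.yosida n) u - u) - (v - u) := by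
    rw [map_sub]
    abel
  rw [h3]
  have h4 := norm_sub_le (NormedSpace.exp ((t : ℝ) • hΓ.yosida n) (v - u)
        + (NormedSpace.exp ((t : ℝ) • hΓ.yosida n) u - u)) (v - u)
  have h5 := norm_add_le (NormedSpace.exp ((t : ℝ) • hΓ.yosida n) (v - u))
    (NormedSpace.exp ((t : ℝ) • hΓ.yosida n) u - u)
  have h6 : (t : ℝ) * ‖w‖ ≤ ε / 3 := le_trans (by nlinarith [t.2]) ht
  linarith

theorem isContractionSemigroup : IsContractionSemigroup hΓ.semigroup where
  zero := by
    ext v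
    refine tendsto_nhds_unique (hΓ.tendsto_semigroup 0 v) ?_
    simp
  add s t := by
    ext v
    refine tendsto_nhds_unique (hΓ.tendsto_semigroup (s + t) v) ?_
    have h1 : ∀ n, NormedSpace.exp (((s + t : ℝ≥0) : ℝ) • hΓ.yosida n) v =
        NormedSpace.exp ((s : ℝ) • hΓ.yosida n)
          (NormedSpace.exp ((t : ℝ) • hΓ.yosida n) v - hΓ.semigroup t v)
        + NormedSpace.exp ((s : ℝ) • hΓ.yosida n) (hΓ.semigroup t v) := fun n => by
      let _ : NormedAlgebra ℚ (H →L[ℂ] H) := NormedAlgebra.restrictScalars ℚ ℝ _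
      rw [NNReal.coe_add, add_smul, NormedSpace.exp_add_of_commute
        (((Commute.refl (hΓ.yosida n)).smul_left _).smul_right _), map_sub, sub_add_cancel]
      rfl
    simp only [h1]
    have h2 : Tendsto (fun n => NormedSpace.exp ((s : ℝ) • hΓ.yosida n)
        (NormedSpace.exp ((t : ℝ) • hΓ.yosida n) v - hΓ.semigroup t v)) atTop (𝓝 0) := by
      refine squeeze_zero_norm
        (fun n => norm_exp_apply_le (hΓ.re_inner_smul_yosida_nonpos s.2 n) _) ?_
      exact tendsto_iff_norm_sub_tendsto_zero.1 (hΓ.tendsto_semigroup t v)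
    simpa using h2.add (hΓ.tendsto_semigroup s (hΓ.semigroup t v))
  contraction t := ContinuousLinearMap.opNorm_le_bound _ zero_le_one fun v => by
    simpa using hΓ.norm_semigroup_apply_le t v
  continuous_zero v := by
    rw [Metric.tendsto_nhds]
    intro ε hε
    obtain ⟨δ, hδ, h⟩ := hΓ.exists_norm_exp_yosida_sub_le v (half_pos hε)
    have h1 : ∀ᶠ t : ℝ≥0 in 𝓝[>] 0, (t : ℝ) ≤ δ :=
      nhdsWithin_le_nhds ((NNReal.continuous_coe.tendsto 0).eventually_le_const (by simpa using hδ))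
    filter_upwards [h1] with t ht
    rw [dist_eq_norm]
    refine lt_of_le_of_lt (le_of_tendsto ((hΓ.tendsto_semigroup t v).sub_const v).norm
      (Eventually.of_forall fun n => h t ht n)) (half_lt_self hε)

/-- The generator of the semigroup extends `G`: the difference quotients of the Yosida semigroups
are close to the values of their generators, uniformly in the approximation. -/
theorem tendsto_quotient_of_mem {v w : H} (h : (v, w) ∈ Γ) :
    Tendsto (fun t : ℝ≥0 => ((t : ℝ) : ℂ)⁻¹ • (hΓ.semigroup t v - v)) (𝓝[>] 0) (𝓝 w) := by
  rw [Metric.tendsto_nhds]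
  intro ε hε
  obtain ⟨δ, hδ, hu⟩ := hΓ.exists_norm_exp_yosida_sub_le w (half_pos hε)
  have h1 : ∀ᶠ t : ℝ≥0 in 𝓝[>] 0, (t : ℝ) ≤ δ :=
    nhdsWithin_le_nhds ((NNReal.continuous_coe.tendsto 0).eventually_le_const (by simpa using hδ))
  filter_upwards [h1, self_mem_nhdsWithin] with t ht ht0
  have ht1 : (0 : ℝ) < t := ht0
  -- the estimate for the `n`-th Yosida approximation
  have h2 : ∀ n, ‖NormedSpace.exp ((t : ℝ) • hΓ.yosida n) v - v - (t : ℝ) • hΓ.approx n w‖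
      ≤ (ε / 2 + ‖w - hΓ.approx n w‖ * 2) * t := fun n => by
    have h3 : ∀ s : ℝ, HasDerivAt
        (fun s : ℝ => NormedSpace.exp (s • hΓ.yosida n) v - s • hΓ.approx n w)
        (NormedSpace.exp (s • hΓ.yosida n) (hΓ.approx n w) - hΓ.approx n w) s := fun s => by
      have h4 := hasDerivAt_exp_smul_apply (hΓ.yosida n) v s
      rw [← commute_exp_apply ((Commute.refl (hΓ.yosida n)).smul_left _),
        hΓ.yosida_apply_of_mem n h] at h4
      have h4' := h4.sub ((hasDerivAt_id s).smul_const (hΓ.approx n w))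
      rw [one_smul] at h4'
      exact h4'
    have h5 := norm_image_sub_le_of_norm_deriv_right_le_segment (a := 0) (b := t)
      (f := fun s : ℝ => NormedSpace.exp (s • hΓ.yosida n) v - s • hΓ.approx n w)
      (f' := fun s => NormedSpace.exp (s • hΓ.yosida n) (hΓ.approx n w) - hΓ.approx n w)
      (C := ε / 2 + ‖w - hΓ.approx n w‖ * 2)
      (fun s _ => (h3 s).continuousAt.continuousWithinAt) (fun s _ => (h3 s).hasDerivWithinAt)
      (fun s hs => ?_) t ⟨t.2, le_rfl⟩
    · simpa [sub_right_comm] using h5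
    · have h6 := hu ⟨s, hs.1⟩ (hs.2.le.trans ht) n
      have h7 : NormedSpace.exp (s • hΓ.yosida n) (hΓ.approx n w) - hΓ.approx n w =
          (NormedSpace.exp (s • hΓ.yosida n) w - w)
          - NormedSpace.exp (s • hΓ.yosida n) (w - hΓ.approx n w) + (w - hΓ.approx n w) := by
        rw [map_sub]
        abel
      have h8 := norm_exp_apply_le (hΓ.re_inner_smul_yosida_nonpos hs.1 n) (w - hΓ.approx n w)
      rw [h7]
      refine (norm_add_le _ _).trans ?_
      have := norm_sub_le (NormedSpace.exp (s • hΓ.yosida n) w - w)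
        (NormedSpace.exp (s • hΓ.yosida n) (w - hΓ.approx n w))
      change ‖NormedSpace.exp (s • hΓ.yosida n) w - w‖ ≤ ε / 2 at h6
      linarith
  have h9 : ‖hΓ.semigroup t v - v - (t : ℝ) • w‖ ≤ (ε / 2 + ‖w - w‖ * 2) * t :=
    le_of_tendsto_of_tendsto'
      (((hΓ.tendsto_semigroup t v).sub_const v).sub ((hΓ.tendsto_approx w).const_smul (t : ℝ))).norm
      ((((tendsto_const_nhds.sub (hΓ.tendsto_approx w)).norm.mul_const 2).const_add
        (ε / 2)).mul_const (t : ℝ)) h2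
  rw [sub_self, norm_zero, zero_mul, add_zero] at h9
  have h10 : ((t : ℝ) : ℂ)⁻¹ • (hΓ.semigroup t v - v) - w =
      ((t : ℝ) : ℂ)⁻¹ • (hΓ.semigroup t v - v - (t : ℝ) • w) := by
    rw [smul_sub _ (hΓ.semigroup t v - v), ← Complex.coe_smul, inv_smul_smul₀]
    exact_mod_cast ht1.ne'
  rw [dist_eq_norm, h10, norm_smul, norm_inv, Complex.norm_real, Real.norm_of_nonneg ht1.le]
  calc (t : ℝ)⁻¹ * _ ≤ (t : ℝ)⁻¹ * (ε / 2 * t) := by gcongr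
    _ = ε / 2 := by field_simp
    _ < ε := half_lt_self hε

/-- The generator of the semigroup is `G` and not a proper extension of it, because `1 - G` is
already onto. -/
theorem mem_of_tendsto_quotient {v w : H}
    (h : Tendsto (fun t : ℝ≥0 => ((t : ℝ) : ℂ)⁻¹ • (hΓ.semigroup t v - v)) (𝓝[>] 0) (𝓝 w)) :
    (v, w) ∈ Γ := by
  have h1 := hΓ.res_mem 0 (v - w)
  simp only [Nat.cast_zero, zero_add, Complex.ofReal_one, one_smul] at h1
  set u := hΓ.res 0 (v - w) with hu
  have h2 := h.sub (hΓ.tendsto_quotient_of_mem h1)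
  have h3 : w - (u - (v - w)) = v - u := by abel
  rw [h3] at h2
  have h4 : Tendsto (fun t : ℝ≥0 => (inner ℂ (v - u) (((t : ℝ) : ℂ)⁻¹ • (hΓ.semigroup t v - v)
      - ((t : ℝ) : ℂ)⁻¹ • (hΓ.semigroup t u - u))).re) (𝓝[>] 0)
      (𝓝 (inner ℂ (v - u) (v - u)).re) :=
    (Complex.continuous_re.tendsto _).comp (tendsto_const_nhds.inner h2)
  have h5 : (inner ℂ (v - u) (v - u)).re ≤ 0 := by
    refine le_of_tendsto h4 (Eventually.of_forall fun t => ?_)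
    have h6 : ((t : ℝ) : ℂ)⁻¹ • (hΓ.semigroup t v - v) - ((t : ℝ) : ℂ)⁻¹ • (hΓ.semigroup t u - u)
        = (((t : ℝ)⁻¹ : ℝ) : ℂ) • (hΓ.semigroup t (v - u) - (v - u)) := by
      rw [map_sub, Complex.ofReal_inv, ← smul_sub]
      congr 1
      abel
    rw [h6, inner_smul_right, Complex.re_ofReal_mul, inner_sub_right, Complex.sub_re]
    refine mul_nonpos_of_nonneg_of_nonpos (inv_nonneg.2 t.2) ?_
    have h7 : (inner ℂ (v - u) (hΓ.semigroup t (v - u))).re ≤ ‖v - u‖ * ‖v - u‖ :=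
      (re_inner_le_norm (𝕜 := ℂ) _ _).trans
        (mul_le_mul_of_nonneg_left (hΓ.norm_semigroup_apply_le t _) (norm_nonneg _))
    have h8 : (inner ℂ (v - u) (v - u)).re = ‖v - u‖ * ‖v - u‖ :=
      inner_self_eq_norm_mul_norm (𝕜 := ℂ) _
    linarith
  have h9 : (inner ℂ (v - u) (v - u)).re = ‖v - u‖ * ‖v - u‖ :=
    inner_self_eq_norm_mul_norm (𝕜 := ℂ) _
  have h10 : v - u = 0 := norm_eq_zero.1 (by nlinarith [norm_nonneg (v - u)])
  have h11 := sub_eq_zero.1 h10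
  rw [← h11] at h1
  simpa using h1

end IsMaximalDissipative

end Generation

end Siegel

/-! ### Orbits of contraction semigroups -/

namespace Siegel

section Semigroups

variable {H : Type*} [NormedAddCommGroup H] [InnerProductSpace ℂ H]

/-- The infinitesimal generator of `T` is the operator with graph `Γ`. -/
def Generates (T : ℝ≥0 → H →L[ℂ] H) (Γ : Submodule ℂ (H × H)) : Prop :=
  ∀ v w : H, Tendsto (fun t : ℝ≥0 => ((t : ℝ) : ℂ)⁻¹ • (T t v - v)) (𝓝[>] 0) (𝓝 w) ↔ (v, w) ∈ Γ

theorem IsMaximalDissipative.generates [CompleteSpace H] {Γ : Submodule ℂ (H × H)}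
    (hΓ : IsMaximalDissipative Γ) : Generates hΓ.semigroup Γ := fun _ _ =>
  ⟨hΓ.mem_of_tendsto_quotient, hΓ.tendsto_quotient_of_mem⟩

/-- A bounded operator that strongly commutes with a maximal dissipative operator commutes with
its resolvents. -/
theorem IsMaximalDissipative.approx_comm {Γ : Submodule ℂ (H × H)} (hΓ : IsMaximalDissipative Γ)
    {C : H →L[ℂ] H} (hC : ∀ v w, (v, w) ∈ Γ → (C v, C w) ∈ Γ) (n : ℕ) (v : H) :
    hΓ.approx n (C v) = C (hΓ.approx n v) := by
  have h1 : hΓ.res n (C v) = C (hΓ.res n v) := by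
    rw [hΓ.res_eq_iff, ← map_smul, ← map_sub]
    exact hC _ _ (hΓ.res_mem n v)
  rw [hΓ.approx_apply, hΓ.approx_apply, h1, map_smul]

namespace IsContractionSemigroup

variable {T : ℝ≥0 → H →L[ℂ] H} (hT : IsContractionSemigroup T)

include hT

theorem norm_apply_le (t : ℝ≥0) (v : H) : ‖T t v‖ ≤ ‖v‖ := by
  simpa using (T t).le_of_opNorm_le (hT.contraction t) v

theorem zero_apply (v : H) : T 0 v = v := by
  rw [hT.zero]
  rfl

theorem add_apply (s t : ℝ≥0) (v : H) : T (s + t) v = T s (T t v) := by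
  rw [hT.add]
  rfl

theorem comm_apply (s t : ℝ≥0) (v : H) : T s (T t v) = T t (T s v) := by
  rw [← hT.add_apply, add_comm, hT.add_apply]

theorem tendsto_nhds_zero (v : H) : Tendsto (fun t => T t v) (𝓝 0) (𝓝 v) := by
  have h1 : (𝓝 (0 : ℝ≥0)) = 𝓝[>] 0 ⊔ pure 0 := by
    rw [sup_comm, ← nhdsWithin_singleton, ← nhdsWithin_union]
    have : ({0} ∪ Set.Ioi 0 : Set ℝ≥0) = Set.univ := by
      ext t
      simp
    rw [this, nhdsWithin_univ]
  rw [h1]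
  refine (hT.continuous_zero v).sup ?_
  rw [tendsto_pure_left]
  intro s hs
  rw [hT.zero_apply]
  exact mem_of_mem_nhds hs

theorem norm_sub_le (s t : ℝ≥0) (v : H) : ‖T t v - T s v‖ ≤ ‖T (nndist t s) v - v‖ := by
  have key : ∀ s t : ℝ≥0, s ≤ t → ‖T t v - T s v‖ ≤ ‖T (nndist t s) v - v‖ := fun s t h => by
    have h1 : nndist t s = t - s := by
      rw [NNReal.nndist_eq, tsub_eq_zero_of_le h, max_eq_left zero_le]
    rw [h1]
    have h2 : T t v - T s v = T s (T (t - s) v - v) := by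
      rw [map_sub, ← hT.add_apply, add_tsub_cancel_of_le h]
    rw [h2]
    exact hT.norm_apply_le _ _
  rcases le_total s t with h | h
  · exact key s t h
  · rw [norm_sub_rev, nndist_comm]
    exact key t s h

theorem continuous_orbit (v : H) : Continuous fun t => T t v := by
  rw [continuous_iff_continuousAt]
  intro s
  rw [ContinuousAt, tendsto_iff_norm_sub_tendsto_zero]
  refine squeeze_zero (fun _ => norm_nonneg _) (fun t => hT.norm_sub_le s t v) ?_
  rw [← tendsto_iff_norm_sub_tendsto_zero]
  refine (hT.tendsto_nhds_zero v).comp ?_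
  have : Tendsto (fun t : ℝ≥0 => nndist t s) (𝓝 s) (𝓝 (nndist s s)) :=
    (continuous_id.nndist continuous_const).tendsto s
  rwa [nndist_self] at this

theorem continuous_orbit_real (v : H) : Continuous fun t : ℝ => T t.toNNReal v :=
  (hT.continuous_orbit v).comp continuous_real_toNNReal

variable {Γ : Submodule ℂ (H × H)} (hG : Generates T Γ)

include hG

/-- The semigroup preserves the domain of its generator and commutes with it. -/
theorem apply_mem {v w : H} (h : (v, w) ∈ Γ) (t : ℝ≥0) : (T t v, T t w) ∈ Γ := by
  rw [← hG] at h ⊢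
  have h1 := ((T t).continuous.tendsto w).comp h
  refine h1.congr fun s => ?_
  simp only [Function.comp_apply, map_smul, map_sub, hT.comm_apply t s]

theorem hasDerivWithinAt_orbit {v w : H} (h : (v, w) ∈ Γ) {t : ℝ} (ht : 0 ≤ t) :
    HasDerivWithinAt (fun s : ℝ => T s.toNNReal v) (T t.toNNReal w) (Set.Ici t) t := by
  rw [← hasDerivWithinAt_Ioi_iff_Ici, hasDerivWithinAt_iff_tendsto_slope' (by simp)]
  have h1 := (hG _ _).2 (hT.apply_mem hG h t.toNNReal)
  have h2 : Tendsto (fun s : ℝ => (s - t).toNNReal) (𝓝[>] t) (𝓝[>] 0) := by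
    refine tendsto_nhdsWithin_iff.2 ⟨?_, ?_⟩
    · have : Tendsto (fun s : ℝ => (s - t).toNNReal) (𝓝 t) (𝓝 (t - t).toNNReal) :=
        (continuous_real_toNNReal.comp (continuous_id.sub continuous_const)).tendsto t
      rw [sub_self, Real.toNNReal_zero] at this
      exact this.mono_left nhdsWithin_le_nhds
    · filter_upwards [self_mem_nhdsWithin] with s hs
      exact Real.toNNReal_pos.2 (sub_pos.2 hs)
  refine (h1.comp h2).congr' ?_
  filter_upwards [self_mem_nhdsWithin] with s hs
  have hs' : 0 ≤ s - t := sub_nonneg.2 (le_of_lt hs)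
  rw [Function.comp_apply, slope_def_module, ← hT.add_apply, ← Real.toNNReal_add hs' ht,
    sub_add_cancel, Real.coe_toNNReal _ hs', ← Complex.ofReal_inv, Complex.coe_smul]

/-- A bounded operator that strongly commutes with the generator intertwines any two semigroups
with this generator: the difference of the two curves has a dissipative right derivative and starts
at zero. -/
theorem intertwine (hΓ : IsMaximalDissipative Γ) {S : ℝ≥0 → H →L[ℂ] H}
    (hS : IsContractionSemigroup S) (hGS : Generates S Γ) {C : H →L[ℂ] H}
    (hC : ∀ v w, (v, w) ∈ Γ → (C v, C w) ∈ Γ) (t : ℝ≥0) (v : H) : S t (C v) = C (T t v) := by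
  have h1 : Set.EqOn (fun v => S t (C v)) (fun v => C (T t v)) {v : H | ∃ w, (v, w) ∈ Γ} := by
    rintro u ⟨w, hw⟩
    have h2 := norm_le_of_deriv_right_dissipative
      (f := fun s : ℝ => S s.toNNReal (C u) - C (T s.toNNReal u))
      (f' := fun s : ℝ => S s.toNNReal (C w) - C (T s.toNNReal w))
      ((hS.continuous_orbit_real _).sub
        (C.continuous.comp (hT.continuous_orbit_real _))).continuousOn
      (fun s hs => (hS.hasDerivWithinAt_orbit hGS (hC _ _ hw) hs).sub
        ((C.restrictScalars ℝ).hasFDerivAt.comp_hasDerivWithinAt s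
          (hT.hasDerivWithinAt_orbit hG hw hs)))
      (fun s hs => hΓ.re_inner_nonpos _ _
        (Γ.sub_mem (hS.apply_mem hGS (hC _ _ hw) _) (hC _ _ (hT.apply_mem hG hw _)))) t.2
    rw [Real.toNNReal_zero, hS.zero_apply, hT.zero_apply, sub_self, norm_zero] at h2
    have h3 := sub_eq_zero.1 (norm_le_zero_iff.1 h2)
    have h4 : Real.toNNReal t.1 = t := Real.toNNReal_coe
    rwa [h4] at h3
  exact congrFun (Continuous.ext_on hΓ.dense ((S t).continuous.comp C.continuous)
    (C.continuous.comp (T t).continuous) h1) v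

theorem eq_of_generates (hΓ : IsMaximalDissipative Γ) {S : ℝ≥0 → H →L[ℂ] H}
    (hS : IsContractionSemigroup S) (hGS : Generates S Γ) : S = T := by
  ext t v
  exact hT.intertwine hG hΓ hS hGS (C := ContinuousLinearMap.id ℂ H) (fun _ _ h => h) t v

/-- An orbit that lies in the domain of the generator for positive times is differentiable there:
the right derivative is continuous, so that the orbit is an integral of it. -/
theorem hasDerivAt_orbit [CompleteSpace H] {v w : H} {t : ℝ}
    (hv : ∃ s : ℝ≥0, (s : ℝ) < t ∧ ∃ u, (T s v, u) ∈ Γ) (hw : (T t.toNNReal v, w) ∈ Γ) :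
    HasDerivAt (fun s : ℝ => T s.toNNReal v) w t := by
  obtain ⟨s, hst, u, hu⟩ := hv
  have h1 : ∀ r : ℝ, 0 ≤ r → T r.toNNReal (T s v) = T s v + ∫ x in (0 : ℝ)..r, T x.toNNReal u := by
    intro r hr
    rw [intervalIntegral.integral_eq_sub_of_hasDeriv_right
      (f := fun r : ℝ => T r.toNNReal (T s v)) (hT.continuous_orbit_real _).continuousOn
      (fun x hx => (hT.hasDerivWithinAt_orbit hG hu
        ((min_eq_left hr).symm.le.trans hx.1.le)).mono Set.Ioi_subset_Ici_self)
      ((hT.continuous_orbit_real u).intervalIntegrable _ _)]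
    rw [Real.toNNReal_zero, hT.zero_apply, add_sub_cancel]
  have h2 : HasDerivAt (fun r : ℝ => T s v + ∫ x in (0 : ℝ)..r, T x.toNNReal u)
      (T (t - s).toNNReal u) (t - s) :=
    (intervalIntegral.integral_hasDerivAt_right
      ((hT.continuous_orbit_real u).intervalIntegrable _ _)
      ((hT.continuous_orbit_real u).stronglyMeasurableAtFilter _ _)
      (hT.continuous_orbit_real u).continuousAt).const_add _
  have h3 := h2.scomp t ((hasDerivAt_id t).sub_const (s : ℝ))
  rw [one_smul] at h3
  have hadd : ∀ r : ℝ, (s : ℝ) ≤ r → ∀ z, T (r - s).toNNReal (T s z) = T r.toNNReal z := by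
    intro r hr z
    rw [← hT.add_apply]
    congr 2
    rw [← NNReal.coe_inj, NNReal.coe_add, Real.coe_toNNReal _ (sub_nonneg.2 hr),
      Real.coe_toNNReal _ (s.2.trans hr), sub_add_cancel]
  have h4 : T (t - s).toNNReal u = w := by
    have h5 := (hG _ _).2 (hT.apply_mem hG hu (t - s).toNNReal)
    rw [hadd t hst.le] at h5
    exact tendsto_nhds_unique h5 ((hG _ _).2 hw)
  rw [h4] at h3
  refine h3.congr_of_eventuallyEq ?_
  filter_upwards [lt_mem_nhds hst] with r hr
  rw [Function.comp_apply, id, ← h1 _ (sub_nonneg.2 hr.le), hadd r hr.le]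

end IsContractionSemigroup

end Semigroups

end Siegel

/-! ### Monomials and sums over words -/

namespace Siegel

section Monomials

variable {H : Type*} [NormedAddCommGroup H] [InnerProductSpace ℂ H]

theorem monomialOp_succ {d : ℕ} (A : Fin (d + 1) → H →L[ℂ] H) (α : Fin (d + 1) → ℕ) :
    monomialOp A α = A 0 ^ α 0 * monomialOp (fun i => A i.succ) (fun i => α i.succ) := by
  simp [monomialOp, List.ofFn_succ]

theorem monomialOp_zero {d : ℕ} (A : Fin d → H →L[ℂ] H) : monomialOp A 0 = 1 := by
  simp [monomialOp]

theorem commute_monomialOp {d : ℕ} {A : Fin d → H →L[ℂ] H} {C : H →L[ℂ] H}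
    (h : ∀ i, Commute C (A i)) (α : Fin d → ℕ) : Commute C (monomialOp A α) := by
  refine Commute.list_prod_right _ _ fun x hx => ?_
  obtain ⟨i, rfl⟩ := (List.mem_ofFn' _ _).1 hx
  exact (h i).pow_right _

theorem monomialOp_add {d : ℕ} {A : Fin d → H →L[ℂ] H} (h : ∀ i j, Commute (A i) (A j))
    (α β : Fin d → ℕ) : monomialOp A (α + β) = monomialOp A α * monomialOp A β := by
  induction d with
  | zero => simp [monomialOp]
  | succ d ih =>
    rw [monomialOp_succ, monomialOp_succ A α, monomialOp_succ A β]
    have h1 : Commute (A 0 ^ β 0) (monomialOp (fun i => A i.succ) (fun i => α i.succ)) :=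
      commute_monomialOp (fun i => (h 0 i.succ).pow_left _) _
    rw [h1.symm.mul_mul_mul_comm, ← pow_add]
    congr 1
    exact ih (fun i j => h i.succ j.succ) (fun i => α i.succ) (fun i => β i.succ)

theorem monomialOp_single {d : ℕ} (A : Fin d → H →L[ℂ] H) (i : Fin d) :
    monomialOp A (Pi.single i 1) = A i := by
  induction d with
  | zero => exact i.elim0
  | succ d ih =>
    rw [monomialOp_succ]
    refine Fin.cases ?_ (fun j => ?_) i
    · have h1 : (fun k : Fin d => (Pi.single 0 1 : Fin (d + 1) → ℕ) k.succ) = 0 := by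
        ext k
        simp
      rw [h1, monomialOp_zero]
      simp
    · have h1 : (fun k : Fin d => (Pi.single j.succ 1 : Fin (d + 1) → ℕ) k.succ)
          = Pi.single j 1 := by
        ext k
        simp [Pi.single_apply]
      rw [h1, ih]
      simp

theorem monomialOp_mem {d : ℕ} {A : Fin d → H →L[ℂ] H} {Γ : Submodule ℂ (H × H)}
    (h : ∀ i v w, (v, w) ∈ Γ → (A i v, A i w) ∈ Γ) (α : Fin d → ℕ) {v w : H} (hv : (v, w) ∈ Γ) :
    (monomialOp A α v, monomialOp A α w) ∈ Γ := by
  have hpow : ∀ i n v w, (v, w) ∈ Γ → ((A i ^ n) v, (A i ^ n) w) ∈ Γ := by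
    intro i n
    induction n with
    | zero => exact fun v w h => h
    | succ n ih =>
      intro v w hvw
      rw [pow_succ]
      exact ih _ _ (h i v w hvw)
  induction d generalizing v w with
  | zero => simpa [monomialOp] using hv
  | succ d ih =>
    rw [monomialOp_succ]
    exact hpow _ _ _ _ (ih (fun i => h i.succ) _ hv fun i => hpow i.succ)

/-- The sum of `g (A_{i₁} ⋯ A_{iₙ} w)` over all words `i₁ ⋯ iₙ` of length `n`. -/
def wordSum {d : ℕ} (A : Fin d → H →L[ℂ] H) (n : ℕ) (g : H → ℝ) : H → ℝ :=
  (fun f w => ∑ i, f (A i w))^[n] g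

theorem wordSum_zero {d : ℕ} (A : Fin d → H →L[ℂ] H) (g : H → ℝ) (w : H) :
    wordSum A 0 g w = g w := rfl

theorem wordSum_succ {d : ℕ} (A : Fin d → H →L[ℂ] H) (n : ℕ) (g : H → ℝ) (w : H) :
    wordSum A (n + 1) g w = ∑ i, wordSum A n g (A i w) := by
  rw [wordSum, Function.iterate_succ_apply']
  rfl

theorem wordSum_nonneg {d : ℕ} (A : Fin d → H →L[ℂ] H) {g : H → ℝ} (hg : ∀ w, 0 ≤ g w) (n : ℕ)
    (w : H) : 0 ≤ wordSum A n g w := by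
  induction n generalizing w with
  | zero => exact hg w
  | succ n ih =>
    rw [wordSum_succ]
    exact Finset.sum_nonneg fun i _ => ih _

theorem continuous_wordSum {d : ℕ} (A : Fin d → H →L[ℂ] H) {g : H → ℝ} (hg : Continuous g)
    (n : ℕ) : Continuous (wordSum A n g) := by
  induction n with
  | zero => exact hg
  | succ n ih =>
    simp only [funext (wordSum_succ A n g)]
    exact continuous_finsetSum _ fun i _ => ih.comp (A i).continuous

theorem multiFactorial_pos {d : ℕ} (α : Fin d → ℕ) : 0 < multiFactorial α :=
  Finset.prod_pos fun i _ => (α i).factorial_pos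

theorem multiFactorial_add_single {d : ℕ} (β : Fin d → ℕ) (i : Fin d) :
    multiFactorial (β + Pi.single i 1) = (β i + 1) * multiFactorial β := by
  rw [multiFactorial, multiFactorial, ← Finset.mul_prod_erase _ _ (Finset.mem_univ i),
    ← Finset.mul_prod_erase _ (fun j => (β j).factorial) (Finset.mem_univ i), ← mul_assoc]
  congr 1
  · simp [Nat.factorial_succ]
  · refine Finset.prod_congr rfl fun j hj => ?_
    simp [Finset.ne_of_mem_erase hj]

/-- The multinomial formula, for sums over words in commuting operators. -/
theorem wordSum_eq_sum {d : ℕ} {A : Fin d → H →L[ℂ] H} (h : ∀ i j, Commute (A i) (A j)) (n : ℕ)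
    (g : H → ℝ) (w : H) : wordSum A n g w =
      n.factorial * ∑ α ∈ Finset.univ.piAntidiag n, g (monomialOp A α w) / multiFactorial α := by
  induction n generalizing w with
  | zero => simp [wordSum_zero, monomialOp_zero, multiFactorial]
  | succ n ih =>
    rw [wordSum_succ]
    simp only [ih]
    rw [← Finset.mul_sum, Nat.factorial_succ, mul_comm (n + 1), Nat.cast_mul, mul_assoc]
    congr 1
    have h1 : ∀ i : Fin d, ∑ β ∈ Finset.univ.piAntidiag n,
        g (monomialOp A β (A i w)) / multiFactorial β =
        ∑ α ∈ Finset.univ.piAntidiag (n + 1),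
          (α i : ℝ) * (g (monomialOp A α w) / multiFactorial α) := by
      intro i
      refine Finset.sum_of_injOn (fun β => β + Pi.single i 1) (fun a _ b _ hab =>
        add_right_cancel hab) (fun β hβ => ?_) (fun α hα hn => ?_) (fun β _ => ?_)
      · have h2 := (Finset.mem_piAntidiag.1 hβ).1
        simp [Finset.mem_piAntidiag, Finset.sum_add_distrib, h2]
      · have h3 : α i = 0 := by
          by_contra h0
          refine hn ⟨α - Pi.single i 1, ?_, ?_⟩
          · have h4 : α - Pi.single i 1 + Pi.single i 1 = α := by
              ext j
              rcases eq_or_ne j i with rfl | hj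
              · simp
                omega
              · simp [hj]
            have h5 := (Finset.mem_piAntidiag.1 hα).1
            rw [← h4] at h5
            simp only [Pi.add_apply, Finset.sum_add_distrib, Finset.sum_pi_single',
              Finset.mem_univ, if_true] at h5
            exact Finset.mem_coe.2 (Finset.mem_piAntidiag.2
              ⟨Nat.add_right_cancel h5, fun j _ => Finset.mem_univ j⟩)
          · ext j
            rcases eq_or_ne j i with rfl | hj
            · simp
              omega
            · simp [hj]
        simp [h3]
      · rw [monomialOp_add h, monomialOp_single, multiFactorial_add_single]
        have h6 := multiFactorial_pos β
        simp only [Pi.add_apply, Pi.single_eq_same]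
        push_cast
        change g (monomialOp A β (A i w)) / _ = _ * (g (monomialOp A β (A i w)) / _)
        field_simp
    rw [Finset.sum_congr rfl fun i _ => h1 i, Finset.sum_comm, Finset.mul_sum]
    refine Finset.sum_congr rfl fun α hα => ?_
    rw [← Finset.sum_mul, ← (Finset.mem_piAntidiag.1 hα).1]
    push_cast
    rfl

theorem tsum_eq_tsum_sum_piAntidiag {d : ℕ} (F : (Fin d → ℕ) → ℝ≥0∞) :
    ∑' α, F α = ∑' n, ∑ α ∈ Finset.univ.piAntidiag n, F α := by
  rw [← (Equiv.sigmaFiberEquiv (deg (d := d))).tsum_eq, ENNReal.tsum_sigma']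
  congr 1
  ext n
  rw [← Finset.tsum_subtype]
  refine (Equiv.subtypeEquivRight fun α => ?_).tsum_eq
    (fun x : {α // α ∈ Finset.univ.piAntidiag n} => F x.1)
  simp [Finset.mem_piAntidiag, deg]

end Monomials

end Siegel

/-! ### The dissipated energy -/

namespace Siegel

section Dissipation

variable {H : Type*} [NormedAddCommGroup H] [InnerProductSpace ℂ H]
  {d : ℕ} {A : Fin d → H →L[ℂ] H} {B : H →ₗ.[ℂ] H}

/-- The graph of `i B`. -/
def genGraph (B : H →ₗ.[ℂ] H) : Submodule ℂ (H × H) := (Complex.I • B).graph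

theorem mem_genGraph {v w : H} :
    (v, w) ∈ genGraph B ↔ ∃ hv : v ∈ B.domain, Complex.I • B ⟨v, hv⟩ = w := by
  rw [genGraph, LinearPMap.mem_graph_iff]
  constructor
  · rintro ⟨⟨y, hy⟩, rfl, h⟩
    exact ⟨hy, h⟩
  · rintro ⟨hv, h⟩
    exact ⟨⟨v, hv⟩, rfl, h⟩

theorem isGenerator_iff {T : ℝ≥0 → H →L[ℂ] H} :
    IsGenerator T (Complex.I • B) ↔ Generates T (genGraph B) := by
  unfold IsGenerator Generates
  simp only [mem_genGraph]
  rfl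

theorem exists_mem_genGraph {v : H} : (∃ w, (v, w) ∈ genGraph B) ↔ v ∈ B.domain :=
  ⟨fun ⟨_, hw⟩ => (mem_genGraph.1 hw).1, fun h => ⟨_, mem_genGraph.2 ⟨h, rfl⟩⟩⟩

theorem im_inner_eq {v : H} (hv : v ∈ B.domain) :
    (inner ℂ v (B ⟨v, hv⟩)).im = -(inner ℂ v (Complex.I • B ⟨v, hv⟩)).re := by
  rw [inner_smul_right, Complex.I_mul_re, neg_neg]

theorem StronglySiegelDissipative.isMaximalDissipative (h : StronglySiegelDissipative A B) :
    IsMaximalDissipative (genGraph B) := by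
  obtain ⟨c, hc, hb⟩ := h.exists_bound
  obtain ⟨ε, hε, hd⟩ := h
  refine ⟨fun v w hvw => ?_, fun x hx => ?_, ?_⟩
  · obtain ⟨hv, rfl⟩ := mem_genGraph.1 hvw
    have h1 := hb ⟨v, hv⟩
    rw [im_inner_eq] at h1
    have h2 : 0 ≤ ∑ i, ‖A i v‖ ^ 2 := by positivity
    have h3 : 0 ≤ c * ‖v‖ ^ 2 := by positivity
    linarith
  · obtain ⟨R, hR⟩ := hd.resolvent (x + ε) (by positivity)
    refine ⟨R, fun v w => ?_⟩
    rw [hR, mem_genGraph]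
    have key : ∀ hw : w ∈ B.domain, (Complex.I • shiftDown B ε) ⟨w, hw⟩
        = (ε : ℂ) • w + Complex.I • B ⟨w, hw⟩ := fun hw => by
      change Complex.I • (-(Complex.I * (ε : ℂ)) • w + B ⟨w, hw⟩) = _
      rw [smul_add, smul_smul, mul_neg, ← mul_assoc, Complex.I_mul_I]
      simp
    refine exists_congr fun hw => ?_
    refine (Eq.congr_left (congrArg (((x + ε : ℝ) : ℂ) • w - ·) (key hw))).trans ?_
    rw [sub_eq_iff_eq_add, eq_sub_iff_add_eq]
    push_cast
    rw [add_smul, add_comm ((x : ℂ) • w), ← add_assoc, add_comm v, add_assoc, add_left_cancel_iff,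
      eq_comm, add_comm]
  · refine hd.dense_domain.mono fun v hv => ?_
    exact exists_mem_genGraph.2 hv

theorem StronglySiegelDissipative.commute (h : StronglySiegelDissipative A B) (i j : Fin d) :
    Commute (A i) (A j) := by
  obtain ⟨ε, hε, hd⟩ := h
  exact hd.commute i j

theorem StronglySiegelDissipative.apply_mem (h : StronglySiegelDissipative A B) (i : Fin d)
    (v w : H) (hvw : (v, w) ∈ genGraph B) : (A i v, A i w) ∈ genGraph B := by
  obtain ⟨ε, hε, hd⟩ := h
  rw [mem_genGraph] at hvw ⊢
  obtain ⟨hv, rfl⟩ := hvw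
  obtain ⟨h1, h2⟩ := hd.strongly_commute i ⟨v, hv⟩
  refine ⟨h1, ?_⟩
  change -(Complex.I * (ε : ℂ)) • A i v + B ⟨A i v, h1⟩
    = A i (-(Complex.I * (ε : ℂ)) • v + B ⟨v, hv⟩) at h2
  rw [map_add, map_smul, add_left_cancel_iff] at h2
  rw [h2, map_smul]

theorem norm_mk_sq (h : StronglySiegelDissipative A B) {v : H} (hv : v ∈ B.domain) :
    ‖HDelta.mk h v hv‖ ^ 2
      = (inner ℂ v (B ⟨v, hv⟩)).im - (1 / 4 : ℝ) * ∑ i, ‖A i v‖ ^ 2 := by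
  rw [← HDelta.innerDelta_self_re (A := A) ⟨v, hv⟩]
  exact (inner_self_eq_norm_sq (𝕜 := ℂ) (HDelta.mk h v hv)).symm

open Classical in
/-- The function `‖v‖_Δ²` on `Dom B`, extended by zero to `H`. -/
noncomputable def deltaSq (h : StronglySiegelDissipative A B) (v : H) : ℝ :=
  if hv : v ∈ B.domain then ‖HDelta.mk h v hv‖ ^ 2 else 0

variable (h : StronglySiegelDissipative A B)

theorem deltaSq_of_mem {v : H} (hv : v ∈ B.domain) : deltaSq h v = ‖HDelta.mk h v hv‖ ^ 2 :=
  dif_pos hv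

theorem deltaSq_nonneg (v : H) : 0 ≤ deltaSq h v := by
  unfold deltaSq
  split_ifs <;> positivity

theorem deltaSq_of_mem_genGraph {v w : H} (hvw : (v, w) ∈ genGraph B) :
    deltaSq h v = -(inner ℂ v w).re - (1 / 4 : ℝ) * ∑ i, ‖A i v‖ ^ 2 := by
  obtain ⟨hv, rfl⟩ := mem_genGraph.1 hvw
  rw [deltaSq_of_mem h hv, norm_mk_sq, im_inner_eq]

theorem exists_le_deltaSq :
    ∃ ε : ℝ, 0 < ε ∧ ∀ v ∈ B.domain, ε * ‖v‖ ^ 2 ≤ deltaSq h v := by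
  obtain ⟨ε, hε, hb⟩ := h.exists_bound
  refine ⟨ε, hε, fun v hv => ?_⟩
  rw [deltaSq_of_mem h hv, norm_mk_sq]
  exact hb ⟨v, hv⟩

/-- Convergence in the graph norm of `B` implies convergence in `H_Δ`. -/
theorem tendsto_mk {ι : Type*} {l : Filter ι} {x y : ι → H} {v w : H}
    (hxy : ∀ i, (x i, y i) ∈ genGraph B) (hvw : (v, w) ∈ genGraph B)
    (hx : Tendsto x l (𝓝 v)) (hy : Tendsto y l (𝓝 w)) (hx' : ∀ i, x i ∈ B.domain)
    (hv : v ∈ B.domain) :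
    Tendsto (fun i => HDelta.mk h (x i) (hx' i)) l (𝓝 (HDelta.mk h v hv)) := by
  rw [tendsto_iff_norm_sub_tendsto_zero]
  have h1 : ∀ i, ‖HDelta.mk h (x i) (hx' i) - HDelta.mk h v hv‖ ^ 2 ≤ ‖x i - v‖ * ‖y i - w‖ := by
    intro i
    have h2 : (x i - v, y i - w) ∈ genGraph B := (genGraph B).sub_mem (hxy i) hvw
    have h3 : x i - v ∈ B.domain := exists_mem_genGraph.1 ⟨_, h2⟩
    change ‖HDelta.mk h (x i - v) h3‖ ^ 2 ≤ _
    rw [← deltaSq_of_mem, deltaSq_of_mem_genGraph h h2]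
    have h4 : 0 ≤ ∑ j, ‖A j (x i - v)‖ ^ 2 := by positivity
    have h5 := neg_le_of_abs_le ((Complex.abs_re_le_norm _).trans
      (norm_inner_le_norm (𝕜 := ℂ) (x i - v) (y i - w)))
    linarith
  have h6 : Tendsto (fun i => ‖x i - v‖ * ‖y i - w‖) l (𝓝 0) := by
    simpa using (tendsto_iff_norm_sub_tendsto_zero.1 hx).mul
      (tendsto_iff_norm_sub_tendsto_zero.1 hy)
  have h7 := (squeeze_zero (fun _ => by positivity) h1 h6).sqrt
  simpa using h7

end Dissipation

/-- The coefficient `t ^ n / (2 ^ n n!)`. -/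
noncomputable def expCoeff (n : ℕ) (t : ℝ) : ℝ := t ^ n / (2 ^ n * n.factorial)

theorem expCoeff_nonneg (n : ℕ) {t : ℝ} (ht : 0 ≤ t) : 0 ≤ expCoeff n t := by
  unfold expCoeff
  positivity

theorem continuous_expCoeff (n : ℕ) : Continuous (expCoeff n) := by
  unfold expCoeff
  fun_prop

theorem hasDerivAt_expCoeff_succ (n : ℕ) (t : ℝ) :
    HasDerivAt (expCoeff (n + 1)) (1 / 2 * expCoeff n t) t := by
  have h1 := (hasDerivAt_pow (n + 1) t).div_const (2 ^ (n + 1) * ((n + 1).factorial : ℝ))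
  refine h1.congr_deriv ?_
  simp only [expCoeff, Nat.factorial_succ, add_tsub_cancel_right]
  push_cast
  field_simp
  ring

section Energy

variable {H : Type*} [NormedAddCommGroup H] [InnerProductSpace ℂ H] [CompleteSpace H]
  {d : ℕ} {A : Fin d → H →L[ℂ] H} {B : H →ₗ.[ℂ] H} (h : StronglySiegelDissipative A B)
  {T : ℝ≥0 → H →L[ℂ] H} (hT : IsContractionSemigroup T) (hG : Generates T (genGraph B))

include h hT hG

omit [CompleteSpace H] in
theorem apply_comm (i : Fin d) (t : ℝ≥0) (v : H) : T t (A i v) = A i (T t v) :=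
  hT.intertwine hG h.isMaximalDissipative hT hG (h.apply_mem i) t v

omit [CompleteSpace H] in
theorem monomialOp_comm (α : Fin d → ℕ) (t : ℝ≥0) (v : H) :
    T t (monomialOp A α v) = monomialOp A α (T t v) :=
  hT.intertwine hG h.isMaximalDissipative hT hG (fun _ _ => monomialOp_mem h.apply_mem α) t v

omit [CompleteSpace H] hT hG in
theorem apply_mem_domain (i : Fin d) {v : H} (hv : v ∈ B.domain) : A i v ∈ B.domain := by
  obtain ⟨w, hw⟩ := exists_mem_genGraph.2 hv
  exact exists_mem_genGraph.1 ⟨_, h.apply_mem i _ _ hw⟩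

omit [CompleteSpace H] h in
theorem semigroup_mem_domain {v : H} (hv : v ∈ B.domain) (t : ℝ≥0) : T t v ∈ B.domain := by
  obtain ⟨w, hw⟩ := exists_mem_genGraph.2 hv
  exact exists_mem_genGraph.1 ⟨_, hT.apply_mem hG hw t⟩

omit [CompleteSpace H] in
theorem orbit_apply_mem_domain {w : H} (hw : ∀ t : ℝ, 0 < t → T t.toNNReal w ∈ B.domain)
    (i : Fin d) (t : ℝ) (ht : 0 < t) : T t.toNNReal (A i w) ∈ B.domain := by
  rw [apply_comm h hT hG]
  exact apply_mem_domain h i (hw t ht)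

theorem hasDerivAt_orbit_norm_sq {w : H} (hw : ∀ t : ℝ, 0 < t → T t.toNNReal w ∈ B.domain)
    {t : ℝ} (ht : 0 < t) : HasDerivAt (fun s : ℝ => ‖T s.toNNReal w‖ ^ 2)
      (-(2 * deltaSq h (T t.toNNReal w) + 1 / 2 * ∑ i, ‖A i (T t.toNNReal w)‖ ^ 2)) t := by
  obtain ⟨u, hu⟩ := exists_mem_genGraph.2 (hw t ht)
  have h1 := hasDerivAt_norm_sq (hT.hasDerivAt_orbit hG
    ⟨(t / 2).toNNReal, by rw [Real.coe_toNNReal _ (by positivity)]; linarith,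
      exists_mem_genGraph.2 (hw (t / 2) (by positivity))⟩ hu)
  convert h1 using 1
  rw [deltaSq_of_mem_genGraph h hu]
  ring

theorem hasDerivAt_wordSum {w : H} (hw : ∀ t : ℝ, 0 < t → T t.toNNReal w ∈ B.domain) (n : ℕ)
    {t : ℝ} (ht : 0 < t) :
    HasDerivAt (fun s : ℝ => wordSum A n (fun v => ‖v‖ ^ 2) (T s.toNNReal w))
      (-(2 * wordSum A n (deltaSq h) (T t.toNNReal w)
        + 1 / 2 * wordSum A (n + 1) (fun v => ‖v‖ ^ 2) (T t.toNNReal w))) t := by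
  induction n generalizing w with
  | zero =>
    simp only [wordSum_succ, wordSum_zero]
    exact hasDerivAt_orbit_norm_sq h hT hG hw ht
  | succ n ih =>
    have h1 := HasDerivAt.fun_sum (u := Finset.univ)
      fun i _ => ih (orbit_apply_mem_domain h hT hG hw i)
    have hc : ∀ (i : Fin d) (s : ℝ≥0), T s (A i w) = A i (T s w) :=
      fun i s => apply_comm h hT hG i s w
    simp only [hc] at h1
    have h2 : (fun s : ℝ => wordSum A (n + 1) (fun v => ‖v‖ ^ 2) (T s.toNNReal w)) =
        fun s => ∑ i, wordSum A n (fun v => ‖v‖ ^ 2) (A i (T s.toNNReal w)) :=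
      funext fun s => wordSum_succ A n _ _
    rw [h2]
    refine h1.congr_deriv ?_
    rw [wordSum_succ A n, wordSum_succ A (n + 1), Finset.sum_neg_distrib,
      Finset.sum_add_distrib, Finset.mul_sum, Finset.mul_sum]

omit [CompleteSpace H] hT hG in
theorem wordSum_le_wordSum_deltaSq {ε : ℝ}
    (hε : ∀ v ∈ B.domain, ε * ‖v‖ ^ 2 ≤ deltaSq h v) (n : ℕ) {v : H} (hv : v ∈ B.domain) :
    ε * wordSum A n (fun v => ‖v‖ ^ 2) v ≤ wordSum A n (deltaSq h) v := by
  induction n generalizing v with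
  | zero => exact hε v hv
  | succ n ih =>
    rw [wordSum_succ, wordSum_succ, Finset.mul_sum]
    exact Finset.sum_le_sum fun i _ => ih (apply_mem_domain h i hv)

variable (A T) in
omit h hT hG [CompleteSpace H] in
/-- The partial sum `∑_{n ≤ N} t ^ n / (2 ^ n n!) ∑ ‖A_{i₁} ⋯ A_{iₙ} e^{i t B} w‖²`, in which the
inner sum runs over the words of length `n`. -/
noncomputable def energy (w : H) (N : ℕ) (t : ℝ) : ℝ :=
  ∑ n ∈ Finset.range (N + 1), expCoeff n t * wordSum A n (fun v => ‖v‖ ^ 2) (T t.toNNReal w)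

variable (T) in
omit hT hG [CompleteSpace H] in
/-- The partial sum `∑_{n ≤ N} t ^ n / (2 ^ n n!) ∑ 2 ‖A_{i₁} ⋯ A_{iₙ} e^{i t B} w‖_Δ²`. -/
noncomputable def energyLoss (w : H) (N : ℕ) (t : ℝ) : ℝ :=
  ∑ n ∈ Finset.range (N + 1), expCoeff n t * (2 * wordSum A n (deltaSq h) (T t.toNNReal w))

variable (A T) in
omit h hT hG [CompleteSpace H] in
/-- The term that is left when the derivative of `energy` is telescoped. -/
noncomputable def energyRest (w : H) (N : ℕ) (t : ℝ) : ℝ :=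
  1 / 2 * expCoeff N t * wordSum A (N + 1) (fun v => ‖v‖ ^ 2) (T t.toNNReal w)

omit [CompleteSpace H] hT hG in
theorem energyLoss_nonneg (w : H) (N : ℕ) {t : ℝ} (ht : 0 ≤ t) : 0 ≤ energyLoss h T w N t :=
  Finset.sum_nonneg fun n _ => mul_nonneg (expCoeff_nonneg n ht)
    (mul_nonneg zero_le_two (wordSum_nonneg A (deltaSq_nonneg h) n _))

omit [CompleteSpace H] h hT hG in
theorem energyRest_nonneg (w : H) (N : ℕ) {t : ℝ} (ht : 0 ≤ t) : 0 ≤ energyRest A T w N t :=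
  mul_nonneg (mul_nonneg (by norm_num) (expCoeff_nonneg N ht))
    (wordSum_nonneg A (fun _ => by positivity) _ _)

omit [CompleteSpace H] h hT hG in
theorem energy_nonneg (w : H) (N : ℕ) {t : ℝ} (ht : 0 ≤ t) : 0 ≤ energy A T w N t :=
  Finset.sum_nonneg fun n _ => mul_nonneg (expCoeff_nonneg n ht)
    (wordSum_nonneg A (fun _ => by positivity) _ _)

theorem hasDerivAt_energy {w : H} (hw : ∀ t : ℝ, 0 < t → T t.toNNReal w ∈ B.domain) (N : ℕ)
    {t : ℝ} (ht : 0 < t) :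
    HasDerivAt (energy A T w N) (-(energyLoss h T w N t + energyRest A T w N t)) t := by
  induction N with
  | zero =>
    have h1 := hasDerivAt_wordSum h hT hG hw 0 ht
    have h2 : energy A T w 0 = fun s => wordSum A 0 (fun v => ‖v‖ ^ 2) (T s.toNNReal w) := by
      ext s
      simp [energy, expCoeff]
    rw [h2]
    refine h1.congr_deriv ?_
    simp [energyLoss, energyRest, expCoeff]
  | succ N ih =>
    have h1 := (hasDerivAt_expCoeff_succ N t).mul (hasDerivAt_wordSum h hT hG hw (N + 1) ht)
    have h2 := ih.add h1
    have h3 : energy A T w (N + 1) = energy A T w N + expCoeff (N + 1) *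
        fun s => wordSum A (N + 1) (fun v => ‖v‖ ^ 2) (T s.toNNReal w) := by
      ext s
      simp [energy, Finset.sum_range_succ _ (N + 1)]
    rw [h3]
    refine h2.congr_deriv ?_
    have h4 : energyLoss h T w (N + 1) t = energyLoss h T w N t + expCoeff (N + 1) t *
        (2 * wordSum A (N + 1) (deltaSq h) (T t.toNNReal w)) := Finset.sum_range_succ _ _
    rw [h4, energyRest, energyRest]
    ring

omit [CompleteSpace H] h hG in
theorem continuous_energy (w : H) (N : ℕ) : Continuous (energy A T w N) :=
  continuous_finsetSum _ fun n _ => (continuous_expCoeff n).mul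
    ((continuous_wordSum A (by fun_prop) n).comp (hT.continuous_orbit_real w))

omit [CompleteSpace H] h hG in
theorem continuous_energyRest (w : H) (N : ℕ) : Continuous (energyRest A T w N) :=
  (continuous_const.mul (continuous_expCoeff N)).mul
    ((continuous_wordSum A (by fun_prop) (N + 1)).comp (hT.continuous_orbit_real w))

omit [CompleteSpace H] h hG in
theorem energy_zero (w : H) (N : ℕ) : energy A T w N 0 = ‖w‖ ^ 2 := by
  rw [energy, Finset.sum_range_succ', Finset.sum_eq_zero]
  · simp [expCoeff, wordSum_zero, hT.zero_apply]
  · intro n _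
    simp [expCoeff]

/-- Strong dissipativity makes the energy decay exponentially, uniformly in the number of terms. -/
theorem energy_le {ε : ℝ} (hε : ∀ v ∈ B.domain, ε * ‖v‖ ^ 2 ≤ deltaSq h v)
    {w : H} (hw : ∀ t : ℝ, 0 < t → T t.toNNReal w ∈ B.domain) (N : ℕ) {t : ℝ} (ht : 0 ≤ t) :
    energy A T w N t ≤ Real.exp (-(2 * ε) * t) * ‖w‖ ^ 2 := by
  have h1 : ∀ s : ℝ, 0 < s → HasDerivAt (fun s => Real.exp (2 * ε * s) * energy A T w N s)
      (Real.exp (2 * ε * s) * (2 * ε) * energy A T w N s + Real.exp (2 * ε * s)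
        * -(energyLoss h T w N s + energyRest A T w N s)) s := fun s hs => by
    have h2 : HasDerivAt (fun s : ℝ => 2 * ε * s) (2 * ε) s := by
      simpa using (hasDerivAt_id s).const_mul (2 * ε)
    exact h2.exp.mul (hasDerivAt_energy h hT hG hw N hs)
  have h3 : AntitoneOn (fun s => Real.exp (2 * ε * s) * energy A T w N s) (Set.Ici 0) := by
    refine antitoneOn_of_deriv_nonpos (convex_Ici 0) ?_ ?_ ?_
    · have := continuous_energy (A := A) hT w N
      exact Continuous.continuousOn (by fun_prop)
    · intro s hs
      rw [interior_Ici] at hs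
      exact (h1 s hs).differentiableAt.differentiableWithinAt
    · intro s hs
      rw [interior_Ici] at hs
      have hs' : 0 < s := hs
      rw [(h1 s hs).deriv]
      have h4 : 2 * ε * energy A T w N s ≤ energyLoss h T w N s := by
        rw [energy, energyLoss, Finset.mul_sum]
        refine Finset.sum_le_sum fun n _ => ?_
        have h5 := wordSum_le_wordSum_deltaSq h hε n (hw s hs)
        have h6 := expCoeff_nonneg n hs'.le
        nlinarith
      have h7 := energyRest_nonneg (A := A) (T := T) w N hs'.le
      have h8 : Real.exp (2 * ε * s) * (2 * ε) * energy A T w N s + Real.exp (2 * ε * s)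
        * -(energyLoss h T w N s + energyRest A T w N s) = -(Real.exp (2 * ε * s)
          * (energyLoss h T w N s - 2 * ε * energy A T w N s + energyRest A T w N s)) := by ring
      rw [h8, neg_nonpos]
      exact mul_nonneg (Real.exp_pos _).le (by linarith)
  have h9 := h3 (Set.mem_Ici.2 le_rfl) (Set.mem_Ici.2 ht) ht
  simp only [mul_zero, Real.exp_zero, one_mul, energy_zero hT] at h9
  rw [neg_mul, Real.exp_neg, ← div_eq_inv_mul, le_div_iff₀ (Real.exp_pos _), mul_comm]
  exact h9

/-- The energy balance on the half-line: all of `‖w‖²` is dissipated. -/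
theorem lintegral_energyLoss_add_energyRest {w : H}
    (hw : ∀ t : ℝ, 0 < t → T t.toNNReal w ∈ B.domain) (N : ℕ) :
    (∫⁻ t in Set.Ioi 0, ENNReal.ofReal (energyLoss h T w N t))
      + ∫⁻ t in Set.Ioi 0, ENNReal.ofReal (energyRest A T w N t) = ENNReal.ofReal (‖w‖ ^ 2) := by
  obtain ⟨ε, hε0, hε⟩ := exists_le_deltaSq h
  have h1 : Tendsto (energy A T w N) atTop (𝓝 0) := by
    have h2 : Tendsto (fun t : ℝ => Real.exp (-(2 * ε) * t) * ‖w‖ ^ 2) atTop (𝓝 0) := by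
      have h3 : Tendsto (fun t : ℝ => -(2 * ε) * t) atTop atBot :=
        tendsto_id.const_mul_atTop_of_neg (by linarith)
      simpa using (Real.tendsto_exp_atBot.comp h3).mul_const (‖w‖ ^ 2)
    refine tendsto_of_tendsto_of_tendsto_of_le_of_le' tendsto_const_nhds h2 ?_ ?_
    · filter_upwards [eventually_ge_atTop 0] with t ht using energy_nonneg w N ht
    · filter_upwards [eventually_ge_atTop 0] with t ht using energy_le h hT hG hε hw N ht
  have h4 : ∀ t ∈ Set.Ioi (0 : ℝ), -(energyLoss h T w N t + energyRest A T w N t) ≤ 0 :=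
    fun t ht => neg_nonpos.2 (add_nonneg (energyLoss_nonneg h w N (le_of_lt ht))
      (energyRest_nonneg w N (le_of_lt ht)))
  have hc := (continuous_energy (A := A) hT w N).continuousWithinAt (s := Set.Ici 0) (x := 0)
  have h5 := integral_Ioi_of_hasDerivAt_of_nonpos hc
    (fun t ht => hasDerivAt_energy h hT hG hw N ht) h4 h1
  have h6 := (integrableOn_Ioi_deriv_of_nonpos hc
    (fun t ht => hasDerivAt_energy h hT hG hw N ht) h4 h1).neg
  have h8 : IntegrableOn (fun t => energyLoss h T w N t + energyRest A T w N t) (Set.Ioi 0) :=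
    h6.congr (Eventually.of_forall fun t => neg_neg _)
  have h7 : Measurable fun t => ENNReal.ofReal (energyRest A T w N t) :=
    (continuous_energyRest hT w N).measurable.ennreal_ofReal
  rw [← lintegral_add_right _ h7]
  rw [energy_zero hT, zero_sub, integral_neg, neg_inj] at h5
  rw [← h5, ofReal_integral_eq_lintegral_ofReal h8]
  · refine setLIntegral_congr_fun measurableSet_Ioi fun t ht => ?_
    exact (ENNReal.ofReal_add (energyLoss_nonneg h w N (le_of_lt ht))
      (energyRest_nonneg w N (le_of_lt ht))).symm
  · refine (ae_restrict_iff' measurableSet_Ioi).2 (Eventually.of_forall fun t ht => ?_)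
    exact neg_nonpos.1 (h4 t ht)

omit [CompleteSpace H] h hG in
theorem energyRest_eq (h : StronglySiegelDissipative A B) (hG : Generates T (genGraph B))
    (w : H) (N : ℕ) (t : ℝ) : energyRest A T w N t = 1 / 2 * ∑ i, expCoeff N t *
      wordSum A N (fun v => ‖v‖ ^ 2) (T t.toNNReal (A i w)) := by
  simp only [energyRest, wordSum_succ, apply_comm h hT hG, Finset.mul_sum, mul_assoc]

/-- The rest term is half of a sum of terms of the energies of the vectors `A i w`. These are
bounded by an integrable function, and at each time are the terms of a convergent series. -/
theorem tendsto_lintegral_energyRest {w : H}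
    (hw : ∀ t : ℝ, 0 < t → T t.toNNReal w ∈ B.domain) :
    Tendsto (fun N => ∫⁻ t in Set.Ioi 0, ENNReal.ofReal (energyRest A T w N t)) atTop (𝓝 0) := by
  obtain ⟨ε, hε0, hε⟩ := exists_le_deltaSq h
  have hle : ∀ i N t, 0 ≤ t → ∑ n ∈ Finset.range (N + 1),
      expCoeff n t * wordSum A n (fun v => ‖v‖ ^ 2) (T t.toNNReal (A i w))
        ≤ Real.exp (-(2 * ε) * t) * ‖A i w‖ ^ 2 := fun i N t ht =>
    energy_le h hT hG hε (orbit_apply_mem_domain h hT hG hw i) N ht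
  have hnn : ∀ i n t, 0 ≤ t →
      0 ≤ expCoeff n t * wordSum A n (fun v => ‖v‖ ^ 2) (T t.toNNReal (A i w)) := fun i n t ht =>
    mul_nonneg (expCoeff_nonneg n ht) (wordSum_nonneg A (fun _ => by positivity) _ _)
  have h0 : ∫⁻ t in Set.Ioi (0 : ℝ), (0 : ℝ≥0∞) = 0 := by simp
  rw [← h0]
  refine tendsto_lintegral_of_dominated_convergence (fun t : ℝ => ENNReal.ofReal
    (1 / 2 * ∑ i, Real.exp (-(2 * ε) * t) * ‖A i w‖ ^ 2))
    (fun N => ENNReal.measurable_ofReal.comp (continuous_energyRest hT w N).measurable) ?_ ?_ ?_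
  · intro N
    refine (ae_restrict_iff' measurableSet_Ioi).2 (Eventually.of_forall fun t ht => ?_)
    refine ENNReal.ofReal_le_ofReal ?_
    rw [energyRest_eq hT h hG]
    refine mul_le_mul_of_nonneg_left (Finset.sum_le_sum fun i _ => ?_) (by norm_num)
    exact (Finset.single_le_sum (f := fun n => expCoeff n t * wordSum A n (fun v => ‖v‖ ^ 2)
      (T t.toNNReal (A i w))) (fun n _ => hnn i n t (le_of_lt ht))
      (Finset.self_mem_range_succ N)).trans (hle i N t (le_of_lt ht))
  · have h1 : IntegrableOn (fun t : ℝ => 1 / 2 * ∑ i, Real.exp (-(2 * ε) * t) * ‖A i w‖ ^ 2)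
        (Set.Ioi 0) := by
      have h2 : IntegrableOn (fun t : ℝ => Real.exp (-(2 * ε) * t)) (Set.Ioi 0) :=
        integrableOn_exp_mul_Ioi (by linarith) 0
      exact (integrable_finsetSum _ fun i _ => Integrable.mul_const h2 _).const_mul _
    exact (lintegral_ofReal_le_lintegral_enorm _).trans_lt h1.2 |>.ne
  · refine (ae_restrict_iff' measurableSet_Ioi).2 (Eventually.of_forall fun t ht => ?_)
    have h3 : Tendsto (fun N => energyRest A T w N t) atTop (𝓝 0) := by
      simp only [energyRest_eq hT h hG]
      have h4 : ∀ i, Tendsto (fun N => expCoeff N t *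
          wordSum A N (fun v => ‖v‖ ^ 2) (T t.toNNReal (A i w))) atTop (𝓝 0) := fun i => by
        refine (summable_of_sum_range_le (c := Real.exp (-(2 * ε) * t) * ‖A i w‖ ^ 2)
          (fun n => hnn i n t (le_of_lt ht)) fun N => ?_).tendsto_atTop_zero
        refine le_trans ?_ (hle i N t (le_of_lt ht))
        rw [Finset.sum_range_succ]
        exact le_add_of_nonneg_right (hnn i N t (le_of_lt ht))
      have h5 := (tendsto_finsetSum Finset.univ fun i _ => h4 i).const_mul (1 / 2 : ℝ)
      rwa [Finset.sum_const_zero, mul_zero] at h5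
    have h6 := ENNReal.tendsto_ofReal h3
    rwa [ENNReal.ofReal_zero] at h6

theorem tendsto_lintegral_energyLoss {w : H}
    (hw : ∀ t : ℝ, 0 < t → T t.toNNReal w ∈ B.domain) :
    Tendsto (fun N => ∫⁻ t in Set.Ioi 0, ENNReal.ofReal (energyLoss h T w N t)) atTop
      (𝓝 (ENNReal.ofReal (‖w‖ ^ 2))) := by
  have h1 : ∀ N, ∫⁻ t in Set.Ioi 0, ENNReal.ofReal (energyLoss h T w N t) =
      ENNReal.ofReal (‖w‖ ^ 2) - ∫⁻ t in Set.Ioi 0, ENNReal.ofReal (energyRest A T w N t) :=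
    fun N => by
      have h2 := lintegral_energyLoss_add_energyRest h hT hG hw N
      have h3 : ∫⁻ t in Set.Ioi 0, ENNReal.ofReal (energyRest A T w N t) ≠ ⊤ :=
        ne_top_of_le_ne_top ENNReal.ofReal_ne_top (le_add_self.trans_eq h2)
      rw [← h2, ENNReal.add_sub_cancel_right h3]
  simp only [h1]
  have h4 := ENNReal.Tendsto.sub (tendsto_const_nhds (x := ENNReal.ofReal (‖w‖ ^ 2)))
    (tendsto_lintegral_energyRest h hT hG hw) (Or.inl ENNReal.ofReal_ne_top)
  rwa [tsub_zero] at h4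

end Energy

end Siegel

/-! ### The norm of `Θ v` -/

namespace Siegel

section Measure

/-- The density of `mu d` with respect to the product of counting and Lebesgue measure. -/
noncomputable def density {d : ℕ} (p : (Fin d → ℕ) × NegReal) : ℝ :=
  (multiFactorial p.1 : ℝ) * (2 / |(p.2 : ℝ)|) ^ deg p.1 * |(p.2 : ℝ)| ^ (2 * d)

/-- The product of the counting measure and Lebesgue measure on `ℕ^d × ℝ_-`. -/
noncomputable def baseMeasure (d : ℕ) : Measure ((Fin d → ℕ) × NegReal) :=
  (Measure.count : Measure (Fin d → ℕ)).prod
    ((volume : Measure ℝ).comap Subtype.val : Measure NegReal)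

theorem mu_eq_withDensity (d : ℕ) :
    mu d = (baseMeasure d).withDensity fun p => ENNReal.ofReal (density p) := rfl

instance instSigmaFiniteNegReal :
    SigmaFinite ((volume : Measure ℝ).comap Subtype.val : Measure NegReal) := by
  have : LocallyCompactSpace NegReal := isOpen_Iio.locallyCompactSpace
  have : IsFiniteMeasureOnCompacts ((volume : Measure ℝ).comap Subtype.val : Measure NegReal) :=
    .comap' _ continuous_subtype_val (MeasurableEmbedding.subtype_coe measurableSet_Iio)
  infer_instance

theorem abs_pos_of_negReal (s : NegReal) : 0 < |(s : ℝ)| := abs_pos.2 (ne_of_lt s.2)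

theorem density_pos {d : ℕ} (p : (Fin d → ℕ) × NegReal) : 0 < density p := by
  have h1 : (0 : ℝ) < multiFactorial p.1 := Nat.cast_pos.2 (multiFactorial_pos _)
  have h2 := abs_pos_of_negReal p.2
  unfold density
  positivity

theorem continuous_density {d : ℕ} : Continuous (density (d := d)) := by
  refine continuous_prod_of_discrete_left.2 fun α => ?_
  have h1 : ∀ s : NegReal, |(s : ℝ)| ≠ 0 := fun s => (abs_pos_of_negReal s).ne'
  have h2 : Continuous fun s : NegReal => |(s : ℝ)| := continuous_subtype_val.abs
  simp only [density]
  exact (continuous_const.mul ((continuous_const.div h2 h1).pow _)).mul (h2.pow _)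

theorem continuous_thetaCoeff {d : ℕ} : Continuous (thetaCoeff (d := d)) := by
  refine continuous_prod_of_discrete_left.2 fun α => ?_
  have h2 : Continuous fun s : NegReal => |(s : ℝ)| := continuous_subtype_val.abs
  simp only [thetaCoeff]
  exact (h2.zpow₀ _ fun s => Or.inl (abs_pos_of_negReal s).ne').div_const _

/-- An integral over `mu d` as a sum of integrals over `(0, ∞)`, in the variable `t = -s`. -/
theorem lintegral_mu {d : ℕ} {F : (Fin d → ℕ) × NegReal → ℝ≥0∞} (hF : Measurable F)
    {G : (Fin d → ℕ) → ℝ → ℝ≥0∞}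
    (h : ∀ α (t : ℝ) (ht : 0 < t), ENNReal.ofReal (density (α, ⟨-t, neg_lt_zero.2 ht⟩)) *
      F (α, ⟨-t, neg_lt_zero.2 ht⟩) = G α t) :
    ∫⁻ p, F p ∂mu d = ∑' α, ∫⁻ t in Set.Ioi 0, G α t := by
  have hd : Measurable fun p : (Fin d → ℕ) × NegReal => ENNReal.ofReal (density p) :=
    continuous_density.measurable.ennreal_ofReal
  rw [mu_eq_withDensity, lintegral_withDensity_eq_lintegral_mul _ hd hF, baseMeasure,
    lintegral_prod _ (hd.mul hF).aemeasurable, lintegral_count]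
  refine tsum_congr fun α => ?_
  have h1 : ∀ s : NegReal,
      ((fun p : (Fin d → ℕ) × NegReal => ENNReal.ofReal (density p)) * F) (α, s)
        = G α (-(s : ℝ)) := fun s => by
    rw [← h α _ (neg_pos.2 s.2)]
    simp
  simp only [h1]
  rw [lintegral_subtype_comap measurableSet_Iio fun x : ℝ => G α (-x)]
  have h2 := (Measure.measurePreserving_neg (volume : Measure ℝ)).setLIntegral_comp_preimage_emb
    (MeasurableEquiv.neg ℝ).measurableEmbedding (G α) (Set.Ioi 0)
  simpa using h2

theorem density_mul_thetaCoeff_sq {d : ℕ} (α : Fin d → ℕ) {t : ℝ} (ht : 0 < t) :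
    density (α, ⟨-t, neg_lt_zero.2 ht⟩) * thetaCoeff (α, ⟨-t, neg_lt_zero.2 ht⟩) ^ 2 =
      (deg α).factorial * expCoeff (deg α) t * 2 / multiFactorial α := by
  have h1 : (0 : ℝ) < multiFactorial α := Nat.cast_pos.2 (multiFactorial_pos _)
  have h2 : (0 : ℝ) < (deg α).factorial := Nat.cast_pos.2 (Nat.factorial_pos _)
  have h3 : ((2 : ℝ) ^ ((deg α : ℝ) - 1 / 2)) ^ 2 = 2 ^ deg α * 2 ^ deg α / 2 := by
    rw [← Real.rpow_natCast, ← Real.rpow_mul zero_le_two, ← Real.rpow_natCast 2 (deg α),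
      ← Real.rpow_add zero_lt_two, ← Real.rpow_sub_one two_ne_zero]
    congr 1
    push_cast
    ring
  simp only [density, thetaCoeff, expCoeff, abs_neg, abs_of_pos ht]
  rw [div_pow (t ^ _), mul_pow (multiFactorial α : ℝ), h3, zpow_sub₀ ht.ne', zpow_natCast,
    zpow_natCast, div_pow 2 t]
  field_simp
  ring

end Measure

section Isometry

variable {H : Type*} [NormedAddCommGroup H] [InnerProductSpace ℂ H]
  {d : ℕ} {A : Fin d → H →L[ℂ] H} {B : H →ₗ.[ℂ] H} (h : StronglySiegelDissipative A B)
  {T : ℝ≥0 → H →L[ℂ] H} (hT : IsContractionSemigroup T) (hG : Generates T (genGraph B))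

theorem negTime_eq (s : NegReal) : negTime s = (-(s : ℝ)).toNNReal :=
  (Real.toNNReal_of_nonneg _).symm

theorem orbit_eq (v : H) (p : (Fin d → ℕ) × NegReal) :
    orbit A T v p = T (-(p.2 : ℝ)).toNNReal (monomialOp A p.1 v) := by
  rw [orbit, negTime_eq]

include hT hG

theorem continuousAt_generator_orbit {w : H} {y : ℝ → H}
    (hy : ∀ t, 0 < t → (T t.toNNReal w, y t) ∈ genGraph B) {t : ℝ} (ht : 0 < t) :
    ContinuousAt y t := by
  have h1 := hy (t / 2) (half_pos ht)
  have h2 : Continuous fun r : ℝ => T (r - t / 2).toNNReal (y (t / 2)) :=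
    (hT.continuous_orbit_real _).comp (continuous_id.sub continuous_const)
  refine h2.continuousAt.congr ?_
  filter_upwards [lt_mem_nhds (half_lt_self ht)] with r hr
  have h3 := hT.apply_mem hG h1 (r - t / 2).toNNReal
  rw [← hT.add_apply, ← Real.toNNReal_add (sub_nonneg.2 hr.le) (half_pos ht).le,
    sub_add_cancel] at h3
  exact tendsto_nhds_unique ((hG _ _).2 h3) ((hG _ _).2 (hy r ((half_pos ht).trans hr)))

theorem continuous_mk_orbit {v : H} (hv : ∀ p, orbit A T v p ∈ B.domain) :
    Continuous fun p => HDelta.mk h (orbit A T v p) (hv p) := by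
  refine continuous_prod_of_discrete_left.2 fun α => ?_
  have h1 : ∀ t : ℝ, 0 < t → ∃ y, (T t.toNNReal (monomialOp A α v), y) ∈ genGraph B := by
    intro t ht
    rw [exists_mem_genGraph]
    have := hv (α, ⟨-t, neg_lt_zero.2 ht⟩)
    rwa [orbit_eq, neg_neg] at this
  choose! y hy using h1
  rw [continuous_iff_continuousAt]
  intro s
  refine tendsto_mk h (y := fun s : NegReal => y (-(s : ℝ))) (w := y (-(s : ℝ)))
    (fun r => ?_) ?_ ?_ ?_ _ _
  · rw [orbit_eq]
    exact hy _ (neg_pos.2 r.2)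
  · rw [orbit_eq]
    exact hy _ (neg_pos.2 s.2)
  · simp only [orbit_eq]
    exact ((hT.continuous_orbit_real _).comp continuous_subtype_val.neg).tendsto s
  · exact (continuousAt_generator_orbit hT hG hy (neg_pos.2 s.2)).tendsto.comp
      (continuous_subtype_val.neg.tendsto s)

theorem continuous_thetaVal {v : H} (hv : ∀ p, orbit A T v p ∈ B.domain) :
    Continuous fun p => thetaVal h T v p (hv p) :=
  (Complex.continuous_ofReal.comp continuous_thetaCoeff).smul (continuous_mk_orbit h hT hG hv)

omit hT hG in
theorem orbit_zero_mem {v : H} (hv : ∀ p, orbit A T v p ∈ B.domain) (t : ℝ) (ht : 0 < t) :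
    T t.toNNReal v ∈ B.domain := by
  have := hv (0, ⟨-t, neg_lt_zero.2 ht⟩)
  rw [orbit_eq, neg_neg, monomialOp_zero] at this
  exact this

variable [CompleteSpace H]

variable (T) in
omit hT hG [CompleteSpace H] in
/-- The integrand of `‖Θ v‖²`, in the variables `(α, t)` with `t = -s > 0`. -/
noncomputable def lossTerm (v : H) (α : Fin d → ℕ) (t : ℝ) : ℝ :=
  (deg α).factorial * expCoeff (deg α) t * 2 / multiFactorial α *
    deltaSq h (monomialOp A α (T t.toNNReal v))

omit [CompleteSpace H] in
theorem density_mul_enorm_thetaVal {v : H} (hv : ∀ p, orbit A T v p ∈ B.domain) (α : Fin d → ℕ)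
    {t : ℝ} (ht : 0 < t) :
    ENNReal.ofReal (density (α, ⟨-t, neg_lt_zero.2 ht⟩)) *
      ‖thetaVal h T v (α, ⟨-t, neg_lt_zero.2 ht⟩) (hv _)‖ₑ ^ 2 =
    ENNReal.ofReal (lossTerm h T v α t) := by
  set p : (Fin d → ℕ) × NegReal := (α, ⟨-t, neg_lt_zero.2 ht⟩) with hp
  have h1 : monomialOp A α (T t.toNNReal v) = orbit A T v p := by
    rw [orbit_eq, hp, neg_neg, monomialOp_comm h hT hG]
  rw [lossTerm, h1, deltaSq_of_mem h (hv p), ← ofReal_norm, ← ENNReal.ofReal_pow (norm_nonneg _),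
    ← ENNReal.ofReal_mul (density_pos p).le, ← density_mul_thetaCoeff_sq α ht, ← hp, thetaVal,
    norm_smul, Complex.norm_real, mul_pow, Real.norm_eq_abs, sq_abs, mul_assoc]

omit [CompleteSpace H] in
theorem aemeasurable_lossTerm {v : H} (hv : ∀ p, orbit A T v p ∈ B.domain) (α : Fin d → ℕ) :
    AEMeasurable (fun t : ℝ => ENNReal.ofReal (lossTerm h T v α t))
      (volume.restrict (Set.Ioi 0)) := by
  refine AEMeasurable.ennreal_ofReal (ContinuousOn.aemeasurable ?_ measurableSet_Ioi)
  have hc : Continuous fun t => (deg α).factorial * expCoeff (deg α) t * 2 / multiFactorial α :=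
    ((continuous_const.mul (continuous_expCoeff _)).mul continuous_const).div_const _
  refine hc.continuousOn.mul ?_
  rw [continuousOn_iff_continuous_domRestrict]
  have h1 := (continuous_mk_orbit h hT hG hv).norm.pow 2
  have h2 : Continuous fun t : Set.Ioi (0 : ℝ) =>
      ((α, ⟨-(t : ℝ), Set.mem_Iio.2 (neg_lt_zero.2 t.2)⟩) : (Fin d → ℕ) × NegReal) :=
    continuous_const.prodMk (continuous_subtype_val.neg.subtype_mk _)
  refine (h1.comp h2).congr fun t => ?_
  rw [Set.domRestrict_apply, ← monomialOp_comm h hT hG]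
  refine (deltaSq_of_mem h (hv _)).symm.trans ?_
  rw [orbit_eq, neg_neg]

omit [CompleteSpace H] hT hG in
theorem sum_lossTerm (v : H) (n : ℕ) (t : ℝ) :
    ∑ α ∈ Finset.univ.piAntidiag n, lossTerm h T v α t
      = expCoeff n t * (2 * wordSum A n (deltaSq h) (T t.toNNReal v)) := by
  rw [wordSum_eq_sum h.commute, Finset.mul_sum, Finset.mul_sum, Finset.mul_sum]
  refine Finset.sum_congr rfl fun α hα => ?_
  have h3 : deg α = n := (Finset.mem_piAntidiag.1 hα).1
  rw [lossTerm, h3]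
  ring

omit [CompleteSpace H] hT hG in
theorem lossTerm_nonneg (v : H) (α : Fin d → ℕ) {t : ℝ} (ht : 0 < t) : 0 ≤ lossTerm h T v α t :=
  mul_nonneg (div_nonneg (mul_nonneg (mul_nonneg (Nat.cast_nonneg _)
    (expCoeff_nonneg _ ht.le)) zero_le_two) (Nat.cast_nonneg _)) (deltaSq_nonneg h _)

omit [CompleteSpace H] hT hG in
theorem ofReal_energyLoss (v : H) (N : ℕ) {t : ℝ} (ht : 0 < t) :
    ENNReal.ofReal (energyLoss h T v N t) = ∑ n ∈ Finset.range (N + 1),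
      ∑ α ∈ Finset.univ.piAntidiag n, ENNReal.ofReal (lossTerm h T v α t) := by
  unfold energyLoss
  rw [ENNReal.ofReal_sum_of_nonneg fun n _ => mul_nonneg (expCoeff_nonneg n ht.le)
    (mul_nonneg zero_le_two (wordSum_nonneg A (deltaSq_nonneg h) n _))]
  refine Finset.sum_congr rfl fun n _ => ?_
  rw [← sum_lossTerm, ENNReal.ofReal_sum_of_nonneg fun α _ => lossTerm_nonneg h v α ht]

theorem lintegral_enorm_thetaVal {v : H} (hv : ∀ p, orbit A T v p ∈ B.domain) :
    ∫⁻ p, ‖thetaVal h T v p (hv p)‖ₑ ^ 2 ∂mu d = ENNReal.ofReal (‖v‖ ^ 2) := by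
  have hc := continuous_thetaVal h hT hG hv
  have hm := aemeasurable_lossTerm h hT hG hv
  rw [lintegral_mu (hc.enorm.measurable.pow_const 2)
    fun α t ht => density_mul_enorm_thetaVal h hT hG hv α ht, tsum_eq_tsum_sum_piAntidiag]
  refine tendsto_nhds_unique
    ((ENNReal.tendsto_nat_tsum _).comp (tendsto_add_atTop_nat 1)) ?_
  refine (tendsto_lintegral_energyLoss h hT hG (orbit_zero_mem hv)).congr fun N => ?_
  rw [Function.comp_apply, setLIntegral_congr_fun measurableSet_Ioi
    fun t ht => ofReal_energyLoss h v N ht, lintegral_finsetSum' _ fun n _ =>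
    Finset.aemeasurable_fun_sum _ fun α _ => hm α]
  exact Finset.sum_congr rfl fun n _ => lintegral_finsetSum' _ fun α _ => hm α

theorem eLpNorm_thetaVal {v : H} (hv : ∀ p, orbit A T v p ∈ B.domain) :
    eLpNorm (fun p => thetaVal h T v p (hv p)) 2 (mu d) = ENNReal.ofReal ‖v‖ := by
  rw [eLpNorm_eq_lintegral_rpow_enorm_toReal two_ne_zero ENNReal.ofNat_ne_top]
  simp only [ENNReal.toReal_ofNat, ENNReal.rpow_ofNat]
  rw [lintegral_enorm_thetaVal h hT hG hv, ENNReal.ofReal_pow (norm_nonneg _),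
    ← ENNReal.rpow_natCast, ← ENNReal.rpow_mul]
  simp

theorem memLp_thetaVal {v : H} (hv : ∀ p, orbit A T v p ∈ B.domain) :
    MemLp (fun p => thetaVal h T v p (hv p)) 2 (mu d) :=
  ⟨(continuous_thetaVal h hT hG hv).aestronglyMeasurable, by
    rw [eLpNorm_thetaVal h hT hG hv]
    exact ENNReal.ofReal_lt_top⟩

end Isometry

end Siegel

/-! ### The isometry `Θ` -/

namespace Siegel

section Theta

variable {H : Type*} [NormedAddCommGroup H] [InnerProductSpace ℂ H] [CompleteSpace H]
  {d : ℕ} {A : Fin d → H →L[ℂ] H} {B : H →ₗ.[ℂ] H} (h : StronglySiegelDissipative A B)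
  {T : ℝ≥0 → H →L[ℂ] H} (hT : IsContractionSemigroup T) (hG : Generates T (genGraph B))

include hT hG

omit [CompleteSpace H] in
include h in
theorem orbit_mem_domain {v : H} (hv : v ∈ B.domain) (p : (Fin d → ℕ) × NegReal) :
    orbit A T v p ∈ B.domain := by
  obtain ⟨w, hw⟩ := exists_mem_genGraph.2 hv
  exact semigroup_mem_domain hT hG
    (exists_mem_genGraph.1 ⟨_, monomialOp_mem h.apply_mem p.1 hw⟩) _

theorem memLp_coe_thetaVal {v : H} (hv : ∀ p, orbit A T v p ∈ B.domain) :
    MemLp (fun p => (thetaVal h T v p (hv p) : UniformSpace.Completion (HDelta h))) 2 (mu d) :=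
  (UniformSpace.Completion.toComplₗᵢ (𝕜 := ℂ) (E := HDelta h)).lipschitz.comp_memLp
    (map_zero _) (memLp_thetaVal h hT hG hv)

omit [CompleteSpace H] hT hG in
theorem orbit_add (A : Fin d → H →L[ℂ] H) (T : ℝ≥0 → H →L[ℂ] H) (v w : H)
    (p : (Fin d → ℕ) × NegReal) : orbit A T (v + w) p = orbit A T v p + orbit A T w p := by
  simp [orbit]

omit [CompleteSpace H] hT hG in
theorem orbit_smul (A : Fin d → H →L[ℂ] H) (T : ℝ≥0 → H →L[ℂ] H) (c : ℂ) (v : H)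
    (p : (Fin d → ℕ) × NegReal) : orbit A T (c • v) p = c • orbit A T v p := by
  simp [orbit]

/-- The map `Θ` on the dense subspace `Dom B`. -/
noncomputable def thetaDom :
    B.domain →ₗ[ℂ] Lp (UniformSpace.Completion (HDelta h)) 2 (mu d) where
  toFun v := (memLp_coe_thetaVal h hT hG (orbit_mem_domain h hT hG v.2)).toLp _
  map_add' v w := by
    rw [← MemLp.toLp_add]
    congr 1
    ext p
    rw [Pi.add_apply, ← UniformSpace.Completion.coe_add, thetaVal, thetaVal, thetaVal, ← smul_add]
    congr 2
    exact Subtype.ext (orbit_add A T v w p)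
  map_smul' c v := by
    rw [RingHom.id_apply, ← MemLp.toLp_const_smul]
    congr 1
    ext p
    rw [Pi.smul_apply, ← UniformSpace.Completion.coe_smul, thetaVal, thetaVal, smul_comm]
    congr 2
    exact Subtype.ext (orbit_smul A T c v p)

theorem coeFn_thetaDom (v : B.domain) : thetaDom h hT hG v =ᵐ[mu d] fun p =>
    (thetaVal h T v p (orbit_mem_domain h hT hG v.2 p) : UniformSpace.Completion (HDelta h)) :=
  (memLp_coe_thetaVal h hT hG (orbit_mem_domain h hT hG v.2)).coeFn_toLp

theorem norm_thetaDom (v : B.domain) : ‖thetaDom h hT hG v‖ = ‖(v : H)‖ := by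
  have h1 : eLpNorm (fun p => (thetaVal h T v p (orbit_mem_domain h hT hG v.2 p) :
      UniformSpace.Completion (HDelta h))) 2 (mu d) = ENNReal.ofReal ‖(v : H)‖ := by
    rw [← eLpNorm_thetaVal h hT hG (orbit_mem_domain h hT hG v.2)]
    exact eLpNorm_congr_norm_ae (Eventually.of_forall fun p =>
      UniformSpace.Completion.norm_coe _)
  change ‖MemLp.toLp _ (memLp_coe_thetaVal h hT hG (orbit_mem_domain h hT hG v.2))‖ = _
  rw [Lp.norm_toLp, h1, ENNReal.toReal_ofReal (norm_nonneg _)]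

omit [CompleteSpace H] hT hG in
include h in
theorem denseRange_domain : DenseRange B.domain.subtype := by
  have h1 := h.isMaximalDissipative.dense
  simp only [exists_mem_genGraph] at h1
  simpa [DenseRange] using h1

theorem exists_isometry : ∃ Θ : H →ₗᵢ[ℂ] Lp (UniformSpace.Completion (HDelta h)) 2 (mu d),
    ∀ v : B.domain, Θ v = thetaDom h hT hG v := by
  have hd : DenseRange B.domain.subtype := denseRange_domain h
  have h1 : ∀ v : B.domain, (thetaDom h hT hG).extendOfNorm B.domain.subtype v
      = thetaDom h hT hG v := fun v =>
    LinearMap.extendOfNorm_eq hd ⟨1, fun v => by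
      rw [norm_thetaDom, one_mul]
      exact le_rfl⟩ v
  refine ⟨⟨((thetaDom h hT hG).extendOfNorm B.domain.subtype).toLinearMap, fun v => ?_⟩, h1⟩
  refine congrFun (hd.equalizer (ContinuousLinearMap.continuous _).norm continuous_norm ?_) v
  ext u
  exact (congrArg norm (h1 u)).trans (norm_thetaDom h hT hG u)

/-- The formula for `Θ v` holds almost everywhere on the set where it makes sense: approximate `v`
by the vectors `n (n - i B)⁻¹ v` of `Dom B`, and use that these operators commute with
`e^{-i s B} A ^ α` and converge strongly to the identity in the graph norm of `B`. -/
theorem coeFn_isometry {Θ : H →ₗᵢ[ℂ] Lp (UniformSpace.Completion (HDelta h)) 2 (mu d)}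
    (hΘ : ∀ v : B.domain, Θ v = thetaDom h hT hG v) (v : H) :
    ∀ᵐ p ∂mu d, ∀ hp : orbit A T v p ∈ B.domain,
      Θ v p = (thetaVal h T v p hp : UniformSpace.Completion (HDelta h)) := by
  have hΓ := h.isMaximalDissipative
  have hJ : ∀ n, hΓ.approx n v ∈ B.domain := fun n =>
    exists_mem_genGraph.1 (hΓ.approx_mem_domain n v)
  have h1 : Tendsto (fun n => Θ (hΓ.approx n v)) atTop (𝓝 (Θ v)) :=
    (Θ.continuous.tendsto v).comp (hΓ.tendsto_approx v)
  obtain ⟨ns, hns, h2⟩ := (tendstoInMeasure_of_tendsto_Lp h1).exists_seq_tendsto_ae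
  have h3 : ∀ᵐ p ∂mu d, ∀ n, Θ (hΓ.approx n v) p = (thetaVal h T (hΓ.approx n v) p
      (orbit_mem_domain h hT hG (hJ n) p) : UniformSpace.Completion (HDelta h)) := by
    rw [ae_all_iff]
    intro n
    rw [hΘ ⟨_, hJ n⟩]
    exact coeFn_thetaDom h hT hG ⟨_, hJ n⟩
  filter_upwards [h2, h3] with p hp2 hp3 hp
  refine tendsto_nhds_unique hp2 ?_
  simp only [hp3]
  refine ((UniformSpace.Completion.continuous_coe (HDelta h)).tendsto _).comp ?_
  refine Tendsto.const_smul ?_ _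
  obtain ⟨w, hw⟩ := exists_mem_genGraph.2 hp
  have h4 : ∀ n, orbit A T (hΓ.approx n v) p = hΓ.approx n (orbit A T v p) := fun n => by
    rw [orbit, orbit, ← hΓ.approx_comm (fun _ _ => monomialOp_mem h.apply_mem p.1),
      hT.intertwine hG hΓ hT hG (fun _ _ hu => hΓ.approx_mem n hu)]
  refine tendsto_mk h (y := fun i => hΓ.approx (ns i) w) (fun i => ?_) hw ?_ ?_ _ _
  · rw [h4]
    exact hΓ.approx_mem _ hw
  · simp only [h4]
    exact (hΓ.tendsto_approx _).comp hns.tendsto_atTop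
  · exact (hΓ.tendsto_approx _).comp hns.tendsto_atTop

end Theta

end Siegel

/-! ### Translations of `ℕ^d × ℝ_-` -/

namespace Siegel

section Shift

variable {d : ℕ}

/-- The translation `(α, s) ↦ (α + γ, s + τ)` of `ℕ^d × ℝ_-`. -/
def shiftMap (γ : Fin d → ℕ) (τ : NegReal) :
    (Fin d → ℕ) × NegReal → (Fin d → ℕ) × NegReal :=
  Prod.map (· + γ) (addNeg · τ)

/-- The coefficient in the formula for the adjoint of the weighted shift. -/
noncomputable def adjCoeff (γ : Fin d → ℕ) (τ : NegReal) (p : (Fin d → ℕ) × NegReal) : ℝ :=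
  |(p.2 : ℝ) + (τ : ℝ)| ^ ((d : ℤ) - (deg p.1 : ℤ) - (deg γ : ℤ))
      / |(p.2 : ℝ)| ^ ((d : ℤ) - (deg p.1 : ℤ))
      * ((multiFactorial (p.1 + γ) : ℝ) / (multiFactorial p.1 : ℝ)) * 2 ^ deg γ

theorem adjShiftFun_apply {E : Type*} [NormedAddCommGroup E] [NormedSpace ℂ E]
    (γ : Fin d → ℕ) (τ : NegReal) (g : (Fin d → ℕ) × NegReal → E) (p : (Fin d → ℕ) × NegReal) :
    adjShiftFun γ τ g p = (adjCoeff γ τ p : ℂ) • g (shiftMap γ τ p) := rfl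

section Coefficients

variable (γ : Fin d → ℕ) (τ : NegReal) (p : (Fin d → ℕ) × NegReal)

theorem deg_add (α β : Fin d → ℕ) : deg (α + β) = deg α + deg β := Finset.sum_add_distrib

theorem abs_add_of_negReal (s t : NegReal) : |(s : ℝ) + (t : ℝ)| = |(s : ℝ)| + |(t : ℝ)| := by
  rw [abs_of_neg (add_neg s.2 t.2), abs_of_neg (Set.mem_Iio.1 s.2),
    abs_of_neg (Set.mem_Iio.1 t.2), neg_add]

theorem factorial_mul_pow_le (m k : ℕ) {a s : ℝ} (ha : 0 ≤ a) (hs : 0 ≤ s) :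
    ((m + k).factorial : ℝ) * (a ^ m * s ^ k)
      ≤ m.factorial * k.factorial * (a + s) ^ (m + k) := by
  have h1 : a ^ m * s ^ k * ((m + k).choose m : ℝ) ≤ (a + s) ^ (m + k) := by
    rw [add_pow]
    have h2 := Finset.single_le_sum
      (f := fun i => a ^ i * s ^ (m + k - i) * ((m + k).choose i : ℝ))
      (s := Finset.range (m + k + 1)) (fun i _ => by positivity)
      (Finset.mem_range.2 (by omega : m < m + k + 1))
    simpa using h2
  have h3 : ((m + k).factorial : ℝ) = (m + k).choose m * m.factorial * k.factorial := by
    have h4 := Nat.choose_mul_factorial_mul_factorial (Nat.le_add_right m k)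
    rw [Nat.add_sub_cancel_left] at h4
    exact_mod_cast h4.symm
  rw [h3]
  have h5 : (0 : ℝ) ≤ m.factorial * k.factorial := by positivity
  nlinarith [mul_le_mul_of_nonneg_left h1 h5]

/-- Each factor is a term of the binomial expansion of `(a + s) ^ (αᵢ + γᵢ)`. -/
theorem multiFactorial_mul_pow_le (α γ : Fin d → ℕ) {a s : ℝ} (ha : 0 ≤ a) (hs : 0 ≤ s) :
    (multiFactorial (α + γ) : ℝ) * (a ^ deg α * s ^ deg γ)
      ≤ multiFactorial α * multiFactorial γ * (a + s) ^ (deg α + deg γ) := by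
  have h1 := Finset.prod_le_prod (s := Finset.univ)
    (f := fun i => ((α i + γ i).factorial : ℝ) * (a ^ α i * s ^ γ i))
    (g := fun i => ((α i).factorial : ℝ) * (γ i).factorial * (a + s) ^ (α i + γ i))
    (fun i _ => by positivity) (fun i _ => factorial_mul_pow_le (α i) (γ i) ha hs)
  simp only [Finset.prod_mul_distrib, Finset.prod_pow_eq_pow_sum, Finset.sum_add_distrib] at h1
  simpa [multiFactorial, deg] using h1

/-- The square of the norm bound for the weighted shift. -/
noncomputable def shiftBound (γ : Fin d → ℕ) (τ : NegReal) : ℝ :=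
  multiFactorial γ * (2 / |(τ : ℝ)|) ^ deg γ

theorem shiftBound_nonneg : 0 ≤ shiftBound γ τ := by
  unfold shiftBound
  positivity

theorem density_shiftMap : density (shiftMap γ τ p) = (multiFactorial (p.1 + γ) : ℝ)
    * (2 / (|(p.2 : ℝ)| + |(τ : ℝ)|)) ^ (deg p.1 + deg γ)
    * (|(p.2 : ℝ)| + |(τ : ℝ)|) ^ (2 * d) := by
  rw [← abs_add_of_negReal, ← deg_add]
  rfl

theorem adjCoeff_eq : adjCoeff γ τ p =
    (|(p.2 : ℝ)| + |(τ : ℝ)|) ^ d / (|(p.2 : ℝ)| + |(τ : ℝ)|) ^ (deg p.1 + deg γ)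
      * |(p.2 : ℝ)| ^ deg p.1 / |(p.2 : ℝ)| ^ d
      * ((multiFactorial (p.1 + γ) : ℝ) / (multiFactorial p.1 : ℝ)) * 2 ^ deg γ := by
  have ha := abs_pos_of_negReal p.2
  have hs := abs_pos_of_negReal τ
  have has := add_pos ha hs
  rw [adjCoeff, abs_add_of_negReal, sub_sub, zpow_sub₀ has.ne', zpow_sub₀ ha.ne',
    ← Nat.cast_add, zpow_natCast, zpow_natCast, zpow_natCast, zpow_natCast]
  field_simp

/-- The coefficient `(|s - τ| / |s|) ^ d` of the weighted shift, at the point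
`shiftMap γ τ (α, s)`. -/
noncomputable def shiftCoeff (τ : NegReal) (p : (Fin d → ℕ) × NegReal) : ℝ :=
  |(p.2 : ℝ)| ^ d / (|(p.2 : ℝ)| + |(τ : ℝ)|) ^ d

theorem density_mul_adjCoeff :
    density p * adjCoeff γ τ p = density (shiftMap γ τ p) * shiftCoeff τ p := by
  have ha := abs_pos_of_negReal p.2
  have hs := abs_pos_of_negReal τ
  have has := add_pos ha hs
  have h1 : (0 : ℝ) < multiFactorial p.1 := Nat.cast_pos.2 (multiFactorial_pos _)
  rw [density_shiftMap, adjCoeff_eq, density, shiftCoeff, div_pow, div_pow]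
  field_simp
  ring

theorem adjCoeff_mul_shiftCoeff_le : adjCoeff γ τ p * shiftCoeff τ p ≤ shiftBound γ τ := by
  have ha := abs_pos_of_negReal p.2
  have hs := abs_pos_of_negReal τ
  have has := add_pos ha hs
  have h1 : (0 : ℝ) < multiFactorial p.1 := Nat.cast_pos.2 (multiFactorial_pos _)
  have h2 := multiFactorial_mul_pow_le p.1 γ ha.le hs.le
  have h3 : adjCoeff γ τ p * shiftCoeff τ p = (multiFactorial (p.1 + γ) : ℝ)
      * |(p.2 : ℝ)| ^ deg p.1 * 2 ^ deg γ
      / (multiFactorial p.1 * (|(p.2 : ℝ)| + |(τ : ℝ)|) ^ (deg p.1 + deg γ)) := by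
    rw [adjCoeff_eq, shiftCoeff]
    field_simp
  rw [h3, shiftBound, div_pow, div_le_iff₀ (by positivity), ← mul_div_assoc, div_mul_eq_mul_div,
    le_div_iff₀ (by positivity)]
  have h4 : (0 : ℝ) ≤ 2 ^ deg γ := by positivity
  nlinarith [mul_le_mul_of_nonneg_right h2 h4]

theorem adjCoeff_nonneg : 0 ≤ adjCoeff γ τ p := by
  unfold adjCoeff
  positivity

theorem shiftCoeff_nonneg : 0 ≤ shiftCoeff τ p := by
  unfold shiftCoeff
  positivity

theorem density_mul_adjCoeff_sq_le :
    density p * adjCoeff γ τ p ^ 2 ≤ shiftBound γ τ * density (shiftMap γ τ p) := by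
  rw [pow_two, ← mul_assoc, density_mul_adjCoeff, mul_assoc, mul_comm (shiftBound γ τ),
    mul_comm (shiftCoeff τ p)]
  exact mul_le_mul_of_nonneg_left (adjCoeff_mul_shiftCoeff_le γ τ p) (density_pos _).le

theorem density_mul_shiftCoeff_sq_le :
    density (shiftMap γ τ p) * shiftCoeff τ p ^ 2 ≤ shiftBound γ τ * density p := by
  rw [pow_two, ← mul_assoc, ← density_mul_adjCoeff, mul_assoc, mul_comm (shiftBound γ τ)]
  exact mul_le_mul_of_nonneg_left (adjCoeff_mul_shiftCoeff_le γ τ p) (density_pos _).le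

theorem adjCoeff_mul_thetaCoeff :
    adjCoeff γ τ p * thetaCoeff (shiftMap γ τ p) = thetaCoeff p := by
  have ha := abs_pos_of_negReal p.2
  have hs := abs_pos_of_negReal τ
  have has := add_pos ha hs
  have h1 : (0 : ℝ) < multiFactorial p.1 := Nat.cast_pos.2 (multiFactorial_pos _)
  have h2 : (0 : ℝ) < multiFactorial (p.1 + γ) := Nat.cast_pos.2 (multiFactorial_pos _)
  have h3 : thetaCoeff (shiftMap γ τ p) =
      (|(p.2 : ℝ)| + |(τ : ℝ)|) ^ (((deg p.1 + deg γ : ℕ) : ℤ) - (d : ℤ))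
        / ((multiFactorial (p.1 + γ) : ℝ)
          * (2 : ℝ) ^ (((deg p.1 + deg γ : ℕ) : ℝ) - 1 / 2)) := by
    rw [← abs_add_of_negReal, ← deg_add]
    rfl
  have h4 : (2 : ℝ) ^ (((deg p.1 + deg γ : ℕ) : ℝ) - 1 / 2)
      = 2 ^ ((deg p.1 : ℝ) - 1 / 2) * 2 ^ deg γ := by
    rw [← Real.rpow_natCast 2 (deg γ), ← Real.rpow_add zero_lt_two]
    congr 1
    push_cast
    ring
  have h5 : (0 : ℝ) < 2 ^ ((deg p.1 : ℝ) - 1 / 2) := by positivity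
  rw [h3, h4, adjCoeff_eq, thetaCoeff, zpow_sub₀ has.ne', zpow_sub₀ ha.ne', zpow_natCast,
    zpow_natCast, zpow_natCast, zpow_natCast]
  set r : ℝ := 2 ^ ((deg p.1 : ℝ) - 1 / 2)
  field_simp

end Coefficients

section Change

variable (γ : Fin d → ℕ) (τ : NegReal)

theorem continuous_addNeg : Continuous fun s : NegReal => addNeg s τ :=
  (continuous_subtype_val.add continuous_const).subtype_mk _

theorem addNeg_injective : Function.Injective fun s : NegReal => addNeg s τ := fun _ _ h =>
  Subtype.ext (add_right_cancel (congrArg Subtype.val h))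

theorem measurableEmbedding_addNeg : MeasurableEmbedding fun s : NegReal => addNeg s τ := by
  have : StandardBorelSpace NegReal := measurableSet_Iio.standardBorel
  exact (continuous_addNeg τ).measurable.measurableEmbedding (addNeg_injective τ)

theorem measurableEmbedding_add : MeasurableEmbedding fun α : Fin d → ℕ => α + γ :=
  (measurable_of_countable _).measurableEmbedding (add_left_injective γ)

theorem measurableEmbedding_shiftMap : MeasurableEmbedding (shiftMap γ τ) :=
  (measurableEmbedding_add γ).prodMap (measurableEmbedding_addNeg τ)

theorem map_add_count : (Measure.count : Measure (Fin d → ℕ)).map (· + γ)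
    = Measure.count.restrict (Set.range (· + γ)) := by
  have he := measurableEmbedding_add γ
  ext s hs
  rw [Measure.map_apply he.measurable hs, Measure.restrict_apply hs,
    Measure.count_apply (he.measurable hs), Measure.count_apply (hs.inter he.measurableSet_range),
    ← Set.image_preimage_eq_inter_range, he.injective.encard_image]

theorem map_addNeg_comap :
    ((volume : Measure ℝ).comap Subtype.val : Measure NegReal).map (addNeg · τ)
      = ((volume : Measure ℝ).comap Subtype.val : Measure NegReal).restrict
        (Set.range (addNeg · τ)) := by
  have he := measurableEmbedding_addNeg τ
  have hv : MeasurableEmbedding (Subtype.val : NegReal → ℝ) :=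
    MeasurableEmbedding.subtype_coe measurableSet_Iio
  ext s hs
  rw [Measure.map_apply he.measurable hs, Measure.restrict_apply hs, hv.comap_apply,
    hv.comap_apply, ← Set.image_preimage_eq_inter_range, Set.image_image]
  have h1 : (fun x : NegReal => ((addNeg x τ : NegReal) : ℝ)) ''
      ((fun x => addNeg x τ) ⁻¹' s) =
      (fun x : ℝ => x + (τ : ℝ)) '' (Subtype.val '' ((fun x => addNeg x τ) ⁻¹' s)) := by
    rw [Set.image_image]
    rfl
  rw [h1, Set.image_add_right, measure_preimage_add_right]

theorem map_shiftMap_baseMeasure :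
    (baseMeasure d).map (shiftMap γ τ) = (baseMeasure d).restrict (Set.range (shiftMap γ τ)) := by
  rw [baseMeasure, shiftMap, ← Measure.map_prod_map _ _ (measurableEmbedding_add γ).measurable
    (measurableEmbedding_addNeg τ).measurable, map_add_count, map_addNeg_comap,
    Measure.prod_restrict, Set.range_prodMap]

theorem lintegral_comp_shiftMap (F : (Fin d → ℕ) × NegReal → ℝ≥0∞) :
    ∫⁻ p, F (shiftMap γ τ p) ∂baseMeasure d
      = ∫⁻ p in Set.range (shiftMap γ τ), F p ∂baseMeasure d := by
  rw [← map_shiftMap_baseMeasure, (measurableEmbedding_shiftMap γ τ).lintegral_map]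

theorem integral_comp_shiftMap (F : (Fin d → ℕ) × NegReal → ℂ) :
    ∫ p, F (shiftMap γ τ p) ∂baseMeasure d
      = ∫ p in Set.range (shiftMap γ τ), F p ∂baseMeasure d := by
  rw [← map_shiftMap_baseMeasure, (measurableEmbedding_shiftMap γ τ).integral_map]

theorem measurable_ofReal_density :
    Measurable fun p : (Fin d → ℕ) × NegReal => ENNReal.ofReal (density p) :=
  continuous_density.measurable.ennreal_ofReal

theorem quasiMeasurePreserving_shiftMap :
    Measure.QuasiMeasurePreserving (shiftMap γ τ) (mu d) (mu d) := by
  refine ⟨(measurableEmbedding_shiftMap γ τ).measurable, ?_⟩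
  have h1 : mu d ≪ baseMeasure d := withDensity_absolutelyContinuous _ _
  have h2 : baseMeasure d ≪ mu d := by
    refine withDensity_absolutelyContinuous' measurable_ofReal_density.aemeasurable ?_
    exact Eventually.of_forall fun p => (ENNReal.ofReal_pos.2 (density_pos p)).ne'
  refine (h1.map (measurableEmbedding_shiftMap γ τ).measurable).trans ?_
  rw [map_shiftMap_baseMeasure]
  exact Measure.absolutelyContinuous_of_le Measure.restrict_le_self |>.trans h2

theorem lintegral_mu_eq {F : (Fin d → ℕ) × NegReal → ℝ≥0∞} (hF : Measurable F) :
    ∫⁻ p, F p ∂mu d = ∫⁻ p, ENNReal.ofReal (density p) * F p ∂baseMeasure d := by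
  rw [mu_eq_withDensity, lintegral_withDensity_eq_lintegral_mul _ measurable_ofReal_density hF]
  rfl

theorem integral_mu_eq (F : (Fin d → ℕ) × NegReal → ℂ) :
    ∫ p, F p ∂mu d = ∫ p, (density p : ℂ) * F p ∂baseMeasure d := by
  rw [mu_eq_withDensity, integral_withDensity_eq_integral_toReal_smul measurable_ofReal_density
    (Eventually.of_forall fun p => ENNReal.ofReal_lt_top)]
  refine integral_congr_ae (Eventually.of_forall fun p => ?_)
  simp only [ENNReal.toReal_ofReal (density_pos p).le, Complex.real_smul]

end Change

end Shift

end Siegel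

/-! ### The weighted shift and its adjoint -/

namespace Siegel

section ShiftOperators

variable {d : ℕ} {E : Type*} [NormedAddCommGroup E] [NormedSpace ℂ E]
  (γ : Fin d → ℕ) (τ : NegReal)

theorem eLpNorm_two_le {X F G : Type*} [MeasurableSpace X] {μ : Measure X} [NormedAddCommGroup F]
    [NormedAddCommGroup G] {f : X → F} {g : X → G} {K : ℝ} (hK : 0 ≤ K)
    (h : ∫⁻ x, ‖f x‖ₑ ^ 2 ∂μ ≤ ENNReal.ofReal K * ∫⁻ x, ‖g x‖ₑ ^ 2 ∂μ) :
    eLpNorm f 2 μ ≤ ENNReal.ofReal (Real.sqrt K) * eLpNorm g 2 μ := by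
  rw [eLpNorm_eq_lintegral_rpow_enorm_toReal two_ne_zero ENNReal.ofNat_ne_top,
    eLpNorm_eq_lintegral_rpow_enorm_toReal two_ne_zero ENNReal.ofNat_ne_top]
  simp only [ENNReal.toReal_ofNat, ENNReal.rpow_ofNat]
  rw [Real.sqrt_eq_rpow, ← ENNReal.ofReal_rpow_of_nonneg hK (by norm_num),
    ← ENNReal.mul_rpow_of_nonneg _ _ (by norm_num)]
  exact ENNReal.rpow_le_rpow h (by norm_num)

theorem continuous_adjCoeff : Continuous (adjCoeff (d := d) γ τ) := by
  refine continuous_prod_of_discrete_left.2 fun α => ?_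
  have h1 : Continuous fun s : NegReal => |(s : ℝ)| := continuous_subtype_val.abs
  have h2 : Continuous fun s : NegReal => |(s : ℝ) + (τ : ℝ)| :=
    (continuous_subtype_val.add continuous_const).abs
  simp only [adjCoeff]
  exact ((((h2.zpow₀ _ fun s => Or.inl (abs_pos_of_negReal (addNeg s τ)).ne').div
    (h1.zpow₀ _ fun s => Or.inl (abs_pos_of_negReal s).ne')
    fun s => (zpow_pos (abs_pos_of_negReal s) _).ne').mul continuous_const).mul continuous_const)

theorem continuous_shiftCoeff : Continuous (shiftCoeff (d := d) τ) := by
  have h1 : Continuous fun p : (Fin d → ℕ) × NegReal => |(p.2 : ℝ)| :=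
    (continuous_subtype_val.comp continuous_snd).abs
  exact (h1.pow d).div ((h1.add continuous_const).pow d)
    fun p => (pow_pos (add_pos (abs_pos_of_negReal p.2) (abs_pos_of_negReal τ)) d).ne'

theorem stronglyMeasurable_adjShiftFun {g : (Fin d → ℕ) × NegReal → E} (hg : StronglyMeasurable g) :
    StronglyMeasurable (adjShiftFun γ τ g) :=
  (Complex.continuous_ofReal.comp (continuous_adjCoeff γ τ)).stronglyMeasurable.smul
    (hg.comp_measurable (measurableEmbedding_shiftMap γ τ).measurable)

theorem lintegral_adjShiftFun_le {g : (Fin d → ℕ) × NegReal → E} (hg : StronglyMeasurable g) :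
    ∫⁻ p, ‖adjShiftFun γ τ g p‖ₑ ^ 2 ∂mu d
      ≤ ENNReal.ofReal (shiftBound γ τ) * ∫⁻ p, ‖g p‖ₑ ^ 2 ∂mu d := by
  rw [lintegral_mu_eq ((stronglyMeasurable_adjShiftFun γ τ hg).enorm.pow_const 2),
    lintegral_mu_eq (hg.enorm.pow_const 2), ← lintegral_const_mul' _ _ ENNReal.ofReal_ne_top]
  refine le_trans (lintegral_mono fun p => ?_) ((lintegral_comp_shiftMap γ τ fun p =>
    ENNReal.ofReal (shiftBound γ τ) * (ENNReal.ofReal (density p) * ‖g p‖ₑ ^ 2)).trans_le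
      (setLIntegral_le_lintegral _ _))
  dsimp only
  rw [adjShiftFun_apply, enorm_smul, mul_pow, ← mul_assoc, ← mul_assoc, ← ofReal_norm (_ : ℂ),
    Complex.norm_real, Real.norm_of_nonneg (adjCoeff_nonneg γ τ p),
    ← ENNReal.ofReal_pow (adjCoeff_nonneg γ τ p), ← ENNReal.ofReal_mul (density_pos p).le,
    ← ENNReal.ofReal_mul (shiftBound_nonneg γ τ)]
  exact mul_le_mul' (ENNReal.ofReal_le_ofReal (density_mul_adjCoeff_sq_le γ τ p)) le_rfl

theorem memLp_of_lintegral_le {X F G : Type*} [MeasurableSpace X] {μ : Measure X}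
    [NormedAddCommGroup F] [NormedAddCommGroup G] {f : X → F} {g : X → G} {K : ℝ} (hK : 0 ≤ K)
    (h : ∫⁻ x, ‖f x‖ₑ ^ 2 ∂μ ≤ ENNReal.ofReal K * ∫⁻ x, ‖g x‖ₑ ^ 2 ∂μ)
    (hf : AEStronglyMeasurable f μ) (hg : MemLp g 2 μ) : MemLp f 2 μ :=
  ⟨hf, (eLpNorm_two_le hK h).trans_lt (ENNReal.mul_lt_top ENNReal.ofReal_lt_top hg.2)⟩

theorem memLp_adjShiftFun (g : Lp E 2 (mu d)) : MemLp (adjShiftFun γ τ g) 2 (mu d) :=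
  memLp_of_lintegral_le (shiftBound_nonneg γ τ)
    (lintegral_adjShiftFun_le γ τ (Lp.stronglyMeasurable g))
    (stronglyMeasurable_adjShiftFun γ τ (Lp.stronglyMeasurable g)).aestronglyMeasurable
    (Lp.memLp g)

theorem adjShiftFun_congr {f g : (Fin d → ℕ) × NegReal → E} (h : f =ᵐ[mu d] g) :
    adjShiftFun γ τ f =ᵐ[mu d] adjShiftFun γ τ g := by
  filter_upwards [(quasiMeasurePreserving_shiftMap γ τ).ae h] with p hp
  rw [adjShiftFun_apply, adjShiftFun_apply, hp]

variable (E) in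
/-- The bounded operator on `L²(μ; E)` given by the formula `adjShiftFun`. -/
noncomputable def adjShift : Lp E 2 (mu d) →L[ℂ] Lp E 2 (mu d) :=
  LinearMap.mkContinuous
    { toFun := fun g => (memLp_adjShiftFun γ τ g).toLp _
      map_add' := fun f g => by
        rw [← MemLp.toLp_add]
        refine MemLp.toLp_congr _ _ ((adjShiftFun_congr γ τ (Lp.coeFn_add f g)).trans ?_)
        exact Eventually.of_forall fun p => smul_add _ _ _
      map_smul' := fun c g => by
        rw [RingHom.id_apply, ← MemLp.toLp_const_smul]
        refine MemLp.toLp_congr _ _ ((adjShiftFun_congr γ τ (Lp.coeFn_smul c g)).trans ?_)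
        exact Eventually.of_forall fun p => smul_comm _ _ _ }
    (Real.sqrt (shiftBound γ τ)) fun g => by
      change ‖(memLp_adjShiftFun γ τ g).toLp _‖ ≤ _
      rw [Lp.norm_toLp, Lp.norm_def, ← ENNReal.toReal_ofReal (Real.sqrt_nonneg (shiftBound γ τ)),
        ← ENNReal.toReal_mul]
      exact ENNReal.toReal_mono (ENNReal.mul_ne_top ENNReal.ofReal_ne_top (Lp.eLpNorm_ne_top g))
        (eLpNorm_two_le (shiftBound_nonneg γ τ)
          (lintegral_adjShiftFun_le γ τ (Lp.stronglyMeasurable g)))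

theorem coeFn_adjShift (g : Lp E 2 (mu d)) :
    adjShift E γ τ g =ᵐ[mu d] adjShiftFun γ τ g :=
  (memLp_adjShiftFun γ τ g).coeFn_toLp

theorem coeFn_elemTensor (φ : Lp ℂ 2 (mu d)) (x : E) :
    elemTensor φ x =ᵐ[mu d] fun p => φ p • x :=
  ContinuousLinearMap.coeFn_compLp _ _

theorem isTensorId_adjShift : IsTensorId (adjShift ℂ γ τ) (adjShift E γ τ) := by
  intro φ x
  refine Lp.ext ((coeFn_adjShift γ τ _).trans ?_)
  refine (adjShiftFun_congr γ τ (coeFn_elemTensor φ x)).trans ?_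
  filter_upwards [coeFn_elemTensor (adjShift ℂ γ τ φ) x, coeFn_adjShift γ τ φ] with p h1 h2
  rw [h1, h2, adjShiftFun_apply, adjShiftFun_apply, smul_smul, smul_eq_mul]

theorem shiftFun_shiftMap (φ : (Fin d → ℕ) × NegReal → ℂ) (p : (Fin d → ℕ) × NegReal) :
    shiftFun γ τ φ (shiftMap γ τ p) = (shiftCoeff τ p : ℂ) * φ p := by
  have h1 : ((shiftMap γ τ p).2 : ℝ) = (p.2 : ℝ) + (τ : ℝ) := rfl
  have h2 : (shiftMap γ τ p).1 = p.1 + γ := rfl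
  have hp : ((shiftMap γ τ p).2 : ℝ) < (τ : ℝ) ∧ γ ≤ (shiftMap γ τ p).1 := by
    refine ⟨?_, ?_⟩
    · rw [h1]
      have : (p.2 : ℝ) < 0 := p.2.2
      linarith
    · rw [h2]
      exact le_add_self
  have h3 : (((shiftMap γ τ p).1 - γ, ⟨((shiftMap γ τ p).2 : ℝ) - (τ : ℝ), sub_neg.2 hp.1⟩) :
      (Fin d → ℕ) × NegReal) = p := by
    refine Prod.ext ?_ (Subtype.ext ?_)
    · simp [h2]
    · simp [h1]
  rw [shiftFun, dif_pos hp, h3, h1, add_sub_cancel_right, abs_add_of_negReal, shiftCoeff]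

theorem shiftFun_of_notMem (φ : (Fin d → ℕ) × NegReal → ℂ) {p : (Fin d → ℕ) × NegReal}
    (hp : p ∉ Set.range (shiftMap γ τ)) : shiftFun γ τ φ p = 0 := by
  refine dif_neg fun h => hp ⟨(p.1 - γ, ⟨(p.2 : ℝ) - (τ : ℝ), sub_neg.2 h.1⟩), ?_⟩
  refine Prod.ext ?_ (Subtype.ext ?_)
  · exact tsub_add_cancel_of_le h.2
  · exact sub_add_cancel _ _

theorem stronglyMeasurable_shiftFun {φ : (Fin d → ℕ) × NegReal → ℂ} (hφ : StronglyMeasurable φ) :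
    StronglyMeasurable (shiftFun γ τ φ) := by
  have h1 : shiftFun γ τ φ =
      Function.extend (shiftMap γ τ) (fun p => (shiftCoeff τ p : ℂ) * φ p) 0 := by
    ext p
    by_cases hp : p ∈ Set.range (shiftMap γ τ)
    · obtain ⟨q, rfl⟩ := hp
      rw [(measurableEmbedding_shiftMap γ τ).injective.extend_apply, shiftFun_shiftMap]
    · rw [shiftFun_of_notMem γ τ φ hp, Function.extend_apply' _ _ _ hp, Pi.zero_apply]
  rw [h1]
  exact (measurableEmbedding_shiftMap γ τ).stronglyMeasurable_extend
    ((Complex.continuous_ofReal.comp (continuous_shiftCoeff τ)).stronglyMeasurable.mul hφ)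
    stronglyMeasurable_zero

theorem lintegral_shiftFun_le {φ : (Fin d → ℕ) × NegReal → ℂ} (hφ : StronglyMeasurable φ) :
    ∫⁻ p, ‖shiftFun γ τ φ p‖ₑ ^ 2 ∂mu d
      ≤ ENNReal.ofReal (shiftBound γ τ) * ∫⁻ p, ‖φ p‖ₑ ^ 2 ∂mu d := by
  rw [lintegral_mu_eq ((stronglyMeasurable_shiftFun γ τ hφ).enorm.pow_const 2),
    lintegral_mu_eq (hφ.enorm.pow_const 2), ← lintegral_const_mul' _ _ ENNReal.ofReal_ne_top]
  have h1 : ∫⁻ p, ENNReal.ofReal (density p) * ‖shiftFun γ τ φ p‖ₑ ^ 2 ∂baseMeasure d =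
      ∫⁻ p in Set.range (shiftMap γ τ),
        ENNReal.ofReal (density p) * ‖shiftFun γ τ φ p‖ₑ ^ 2 ∂baseMeasure d := by
    refine (setLIntegral_eq_of_support_subset ?_).symm
    intro p hp
    by_contra h
    exact hp (by simp [shiftFun_of_notMem γ τ φ h])
  rw [h1, ← lintegral_comp_shiftMap]
  refine lintegral_mono fun p => ?_
  rw [shiftFun_shiftMap, enorm_mul, mul_pow, ← mul_assoc, ← mul_assoc, ← ofReal_norm (_ : ℂ),
    Complex.norm_real, Real.norm_of_nonneg (shiftCoeff_nonneg τ p),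
    ← ENNReal.ofReal_pow (shiftCoeff_nonneg τ p), ← ENNReal.ofReal_mul (density_pos _).le,
    ← ENNReal.ofReal_mul (shiftBound_nonneg γ τ)]
  exact mul_le_mul' (ENNReal.ofReal_le_ofReal (density_mul_shiftCoeff_sq_le γ τ p)) le_rfl

theorem memLp_shiftFun (φ : Lp ℂ 2 (mu d)) : MemLp (shiftFun γ τ φ) 2 (mu d) :=
  memLp_of_lintegral_le (shiftBound_nonneg γ τ)
    (lintegral_shiftFun_le γ τ (Lp.stronglyMeasurable φ))
    (stronglyMeasurable_shiftFun γ τ (Lp.stronglyMeasurable φ)).aestronglyMeasurable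
    (Lp.memLp φ)

/-- The weighted shift is the adjoint of `adjShift`: substitute `shiftMap γ τ` in the integral that
defines the inner product. -/
theorem isWeightedShift_adjoint :
    IsWeightedShift γ τ (ContinuousLinearMap.adjoint (adjShift ℂ γ τ)) := by
  intro φ
  have h1 : ContinuousLinearMap.adjoint (adjShift ℂ γ τ) φ = (memLp_shiftFun γ τ φ).toLp _ := by
    refine ext_inner_left ℂ fun ψ => ?_
    rw [ContinuousLinearMap.adjoint_inner_right, L2.inner_def, L2.inner_def]
    have h2 : ∫ p, inner ℂ (adjShift ℂ γ τ ψ p) (φ p) ∂mu d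
        = ∫ p, inner ℂ (adjShiftFun γ τ ψ p) (φ p) ∂mu d := by
      refine integral_congr_ae ?_
      filter_upwards [coeFn_adjShift γ τ ψ] with p hp
      rw [hp]
    have h3 : ∫ p, inner ℂ (ψ p) ((memLp_shiftFun γ τ φ).toLp _ p) ∂mu d
        = ∫ p, inner ℂ (ψ p) (shiftFun γ τ φ p) ∂mu d := by
      refine integral_congr_ae ?_
      filter_upwards [(memLp_shiftFun γ τ φ).coeFn_toLp] with p hp
      rw [hp]
    rw [h2, h3, integral_mu_eq, integral_mu_eq,
      ← setIntegral_eq_integral_of_forall_compl_eq_zero (s := Set.range (shiftMap γ τ))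
        (f := fun p => (density p : ℂ) * inner ℂ (ψ p) (shiftFun γ τ φ p))
        (fun p hp => by rw [shiftFun_of_notMem γ τ φ hp, inner_zero_right, mul_zero]),
      ← integral_comp_shiftMap]
    refine integral_congr_ae (Eventually.of_forall fun p => ?_)
    dsimp only
    rw [shiftFun_shiftMap, adjShiftFun_apply, inner_smul_left, Complex.conj_ofReal,
      ← smul_eq_mul (_ : ℂ) (φ p), inner_smul_right, ← mul_assoc, ← mul_assoc,
      ← Complex.ofReal_mul, ← Complex.ofReal_mul, density_mul_adjCoeff]
  rw [h1]
  exact (memLp_shiftFun γ τ φ).coeFn_toLp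

end ShiftOperators

section Intertwining

variable {H : Type*} [NormedAddCommGroup H] [InnerProductSpace ℂ H] [CompleteSpace H]
  {d : ℕ} {A : Fin d → H →L[ℂ] H} {B : H →ₗ.[ℂ] H} (h : StronglySiegelDissipative A B)
  {T : ℝ≥0 → H →L[ℂ] H} (hT : IsContractionSemigroup T) (hG : Generates T (genGraph B))
  (γ : Fin d → ℕ) (τ : NegReal)

include h hT hG

omit [CompleteSpace H] in
theorem orbit_shiftMap (v : H) (p : (Fin d → ℕ) × NegReal) :
    orbit A T (T (negTime τ) (monomialOp A γ v)) p = orbit A T v (shiftMap γ τ p) := by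
  have h1 : negTime (shiftMap γ τ p).2 = negTime p.2 + negTime τ := by
    rw [← NNReal.coe_inj, NNReal.coe_add]
    exact neg_add _ _
  have h2 : monomialOp A (shiftMap γ τ p).1 v = monomialOp A p.1 (monomialOp A γ v) := by
    change monomialOp A (p.1 + γ) v = _
    rw [monomialOp_add h.commute]
    rfl
  rw [orbit, orbit, ← monomialOp_comm h hT hG, h1, h2, hT.add_apply]

theorem isometry_intertwines {Θ : H →ₗᵢ[ℂ] Lp (UniformSpace.Completion (HDelta h)) 2 (mu d)}
    (hΘ : ∀ v : B.domain, Θ v = thetaDom h hT hG v) (v : H) :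
    Θ (T (negTime τ) (monomialOp A γ v)) = adjShift _ γ τ (Θ v) := by
  have hd : DenseRange B.domain.subtype := denseRange_domain h
  refine congrFun (hd.equalizer (g := fun v => Θ (T (negTime τ) (monomialOp A γ v)))
    (h := fun v => adjShift _ γ τ (Θ v)) (by fun_prop)
    ((ContinuousLinearMap.continuous _).comp Θ.continuous) ?_) v
  ext1 u
  have hu : T (negTime τ) (monomialOp A γ u) ∈ B.domain := by
    obtain ⟨w, hw⟩ := exists_mem_genGraph.2 u.2
    exact semigroup_mem_domain hT hG
      (exists_mem_genGraph.1 ⟨_, monomialOp_mem h.apply_mem γ hw⟩) _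
  change Θ (T (negTime τ) (monomialOp A γ u)) = adjShift _ γ τ (Θ u)
  have h1 := hΘ ⟨_, hu⟩
  change Θ (T (negTime τ) (monomialOp A γ u)) = _ at h1
  rw [h1, hΘ u]
  refine Lp.ext ((coeFn_thetaDom h hT hG ⟨_, hu⟩).trans (EventuallyEq.symm ?_))
  refine (coeFn_adjShift γ τ _).trans
    ((adjShiftFun_congr γ τ (coeFn_thetaDom h hT hG u)).trans ?_)
  refine Eventually.of_forall fun p => ?_
  dsimp only
  rw [adjShiftFun_apply, ← UniformSpace.Completion.coe_smul, thetaVal, thetaVal, smul_smul,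
    ← Complex.ofReal_mul, adjCoeff_mul_thetaCoeff]
  congr 2
  exact Subtype.ext (orbit_shiftMap h hT hG γ τ (u : H) p).symm

end Intertwining

end Siegel

theorem theorem1p5 {H : Type*} [NormedAddCommGroup H] [InnerProductSpace ℂ H] [CompleteSpace H]
    {d : ℕ} (A : Fin d → H →L[ℂ] H) (B : H →ₗ.[ℂ] H)
    (h : Siegel.StronglySiegelDissipative A B) :
    -- `i B` generates a unique contraction semigroup `T`, `T t = e^{i t B}`
    (∃! T : ℝ≥0 → H →L[ℂ] H,
      Siegel.IsContractionSemigroup T ∧ Siegel.IsGenerator T (Complex.I • B)) ∧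
    ∀ T : ℝ≥0 → H →L[ℂ] H,
      Siegel.IsContractionSemigroup T → Siegel.IsGenerator T (Complex.I • B) →
      -- the formula for `Θ v` makes sense everywhere when `v ∈ Dom B`
      (∀ v ∈ B.domain, ∀ p, Siegel.orbit A T v p ∈ B.domain) ∧
      -- whenever it makes sense everywhere, it is an element of `L²(μ; H_Δ)` of norm `‖v‖`
      (∀ (v : H) (hv : ∀ p, Siegel.orbit A T v p ∈ B.domain),
        MemLp (fun p => Siegel.thetaVal h T v p (hv p)) 2 (Siegel.mu d) ∧
        eLpNorm (fun p => Siegel.thetaVal h T v p (hv p)) 2 (Siegel.mu d)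
          = ENNReal.ofReal ‖v‖) ∧
      -- `Θ` is an isometric embedding of all of `H`, given by the formula wherever it makes sense
      ∃ Θ : H →ₗᵢ[ℂ] Lp (UniformSpace.Completion (Siegel.HDelta h)) 2 (Siegel.mu d),
        (∀ v : H, ∀ᵐ p ∂(Siegel.mu d), ∀ hp : Siegel.orbit A T v p ∈ B.domain,
          Θ v p = (Siegel.thetaVal h T v p hp : UniformSpace.Completion (Siegel.HDelta h))) ∧
        -- `Θ` intertwines `e^{-i τ B} A ^ γ` and `S_{γ,τ}^* ⊗ Id`
        ∀ (γ : Fin d → ℕ) (τ : Siegel.NegReal),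
          ∃ S : Lp ℂ 2 (Siegel.mu d) →L[ℂ] Lp ℂ 2 (Siegel.mu d),
            Siegel.IsWeightedShift γ τ S ∧
            ∃ W : Lp (UniformSpace.Completion (Siegel.HDelta h)) 2 (Siegel.mu d) →L[ℂ]
                Lp (UniformSpace.Completion (Siegel.HDelta h)) 2 (Siegel.mu d),
              Siegel.IsTensorId (ContinuousLinearMap.adjoint S) W ∧
              (∀ g, W g =ᵐ[Siegel.mu d] Siegel.adjShiftFun γ τ g) ∧
              ∀ v : H, Θ (T (Siegel.negTime τ) (Siegel.monomialOp A γ v)) = W (Θ v) := by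
  have hΓ := h.isMaximalDissipative
  refine ⟨⟨hΓ.semigroup, ⟨hΓ.isContractionSemigroup, Siegel.isGenerator_iff.2 hΓ.generates⟩,
    fun S hS => hΓ.isContractionSemigroup.eq_of_generates hΓ.generates hΓ hS.1
      (Siegel.isGenerator_iff.1 hS.2)⟩, fun T hT hgen => ?_⟩
  have hG := Siegel.isGenerator_iff.1 hgen
  obtain ⟨Θ, hΘ⟩ := Siegel.exists_isometry h hT hG
  refine ⟨fun v hv => Siegel.orbit_mem_domain h hT hG hv,
    fun v hv => ⟨Siegel.memLp_thetaVal h hT hG hv, Siegel.eLpNorm_thetaVal h hT hG hv⟩,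
    Θ, Siegel.coeFn_isometry h hT hG hΘ, fun γ τ =>
    ⟨ContinuousLinearMap.adjoint (Siegel.adjShift ℂ γ τ), Siegel.isWeightedShift_adjoint γ τ,
      Siegel.adjShift _ γ τ, ?_, Siegel.coeFn_adjShift γ τ,
      Siegel.isometry_intertwines h hT hG γ τ hΘ⟩⟩
  rw [ContinuousLinearMap.adjoint_adjoint]
  exact Siegel.isTensorId_adjShift γ τ
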